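/- Let $f\in\mathbb C[y_0,\dots,y_4]$ be a homogeneous polynomial (of any degree $d$) such that every singular point of the hypersurface $X=\{f=0\}\subset\mathbb P^4$ is a node (ordinary double point), and let $\Sigma$ be its singular locus. Let $\pi:\widehat{\mathbb P}^4\to\mathbb P^4$ be the blow-up of $\mathbb P^4$ along $\Sigma$ (reduced), with exceptional divisor $E=\pi^{-1}(\Sigma)$, and let $\widetilde X\subset\widehat{\mathbb P}^4$ be the strict transform of $X$ (so that $\pi$ restricts to the blow-up $\widetilde X\to X$ of $X$ along $\Sigma$). For integers $n,m\ge 0$ let $\Omega^4_{\mathbb P^4}(n,m)$ be the sheaf on $\mathbb P^4$ (Zariski topology) of rational 4-forms $\omega$ that have at most a pole of order $n$ along $X$ and no other pole, and that are at least $m$-adjoint relative to $\Sigma$: near each $p\in\Sigma$, in local coordinates $z_1,\dots,z_4$ and with a local equation $g$ of $X$, $\omega=\frac{F}{g^n}\,dz_1\wedge dz_2\wedge dz_3\wedge dz_4$ with $F$ regular at $p$ of multiplicity $\mu_p(F)\ge m$, i.e. $F\in\mathfrak m_p^m$. Let $\Omega^4_{\widehat{\mathbb P}^4}(n\widetilde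 X)$ be the sheaf of rational 4-forms on $\widehat{\mathbb P}^4$ that have at most a pole of order $n$ along $\widetilde X$ and no other pole. Suppose that $N=2n-3$ is positive and $m\ge N$. Then $\pi^*\big(\Omega^4_{\mathbb P^4}(n,m)\big)\subset\Omega^4_{\widehat{\mathbb P}^4}(n\widetilde X)$: for every Zariski open $U\subset\mathbb P^4$ and every $\omega\in\Omega^4_{\mathbb P^4}(n,m)(U)$, the pullback $\pi^*\omega$ has on $\pi^{-1}(U)$ at most a pole of order $n$ along $\widetilde X$ and no other pole. In particular $\pi^*\omega$ has no pole along the exceptional divisor: it is regular at every point of $E\cap\pi^{-1}(U)$ that is not on $\widetilde X$. -/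

import Mathlib

open MvPolynomial
open scoped LinearAlgebra.Projectivization KaehlerDifferential

noncomputable section

namespace NodalForms

/-! ## Function fields and local rings of parametrised multiprojective varieties

`σ` indexes the coordinates of a product of projective spaces, `w j` is the multidegree of the
`j`-th coordinate, and `θ : σ → ℂ[ι]` is a polynomial parametrisation of a dense subset of an
irreducible closed subvariety `Z` of the product.  A multihomogeneous polynomial `B` vanishes on `Z`
iff `B(θ) = 0`, so that evaluation at `θ` (the generic point) identifies the rational functions
on `Z`, which are the fractions `A / B` of multihomogeneous polynomials of the same multidegree
with `B` not vanishing identically on `Z`, with a subalgebra of `Frac ℂ[ι]`. -/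

section Multiprojective

variable {ι σ M : Type} [AddCommMonoid M]

/-- The field of rational functions on `Z`. -/
def functionField (w : σ → M) (θ : σ → MvPolynomial ι ℂ) :
    Subalgebra ℂ (FractionRing (MvPolynomial ι ℂ)) where
  carrier := {g | ∃ (k : M) (A B : MvPolynomial σ ℂ), IsWeightedHomogeneous w A k ∧
    IsWeightedHomogeneous w B k ∧ aeval θ B ≠ 0 ∧
    g = algebraMap _ (FractionRing (MvPolynomial ι ℂ)) (aeval θ A) / algebraMap _ _ (aeval θ B)}
  mul_mem' := by
    rintro _ _ ⟨k, A, B, hA, hB, h0, rfl⟩ ⟨k', A', B', hA', hB', h0', rfl⟩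
    refine ⟨k + k', A * A', B * B', hA.mul hA', hB.mul hB', ?_, ?_⟩
    · simpa using ⟨h0, h0'⟩
    · simp only [map_mul, div_mul_div_comm]
  add_mem' := by
    rintro _ _ ⟨k, A, B, hA, hB, h0, rfl⟩ ⟨k', A', B', hA', hB', h0', rfl⟩
    refine ⟨k + k', A * B' + B * A', B * B', (hA.mul hB').add (hB.mul hA'), hB.mul hB', ?_, ?_⟩
    · simpa using ⟨h0, h0'⟩
    · have e := (IsFractionRing.injective (MvPolynomial ι ℂ) (FractionRing (MvPolynomial ι ℂ))).ne h0
      have e' := (IsFractionRing.injective (MvPolynomial ι ℂ)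
        (FractionRing (MvPolynomial ι ℂ))).ne h0'
      rw [map_zero] at e e'
      simp only [map_mul, map_add, div_add_div _ _ e e']
  algebraMap_mem' := by
    intro c
    refine ⟨0, C c, 1, isWeightedHomogeneous_C w c, isWeightedHomogeneous_one ℂ w, by simp, ?_⟩
    rw [map_one, map_one, div_one, aeval_C, ← IsScalarTower.algebraMap_apply]

/-- The local ring of `Z` at its point with multihomogeneous coordinates `a`: the rational
functions that can be written as `A / B` with `B(a) ≠ 0`. -/
def localRing (w : σ → M) (θ : σ → MvPolynomial ι ℂ) (a : σ → ℂ) :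
    Subalgebra ℂ (functionField w θ) where
  carrier := {g | ∃ (k : M) (A B : MvPolynomial σ ℂ), IsWeightedHomogeneous w A k ∧
    IsWeightedHomogeneous w B k ∧ aeval θ B ≠ 0 ∧ eval a B ≠ 0 ∧
    (g : FractionRing (MvPolynomial ι ℂ)) =
      algebraMap _ (FractionRing (MvPolynomial ι ℂ)) (aeval θ A) / algebraMap _ _ (aeval θ B)}
  mul_mem' := by
    rintro x y ⟨k, A, B, hA, hB, h0, ha, hx⟩ ⟨k', A', B', hA', hB', h0', ha', hy⟩
    refine ⟨k + k', A * A', B * B', hA.mul hA', hB.mul hB', ?_, ?_, ?_⟩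
    · simpa using ⟨h0, h0'⟩
    · simpa using ⟨ha, ha'⟩
    · simp only [map_mul, MulMemClass.coe_mul, hx, hy, div_mul_div_comm]
  add_mem' := by
    rintro x y ⟨k, A, B, hA, hB, h0, ha, hx⟩ ⟨k', A', B', hA', hB', h0', ha', hy⟩
    refine ⟨k + k', A * B' + B * A', B * B', (hA.mul hB').add (hB.mul hA'), hB.mul hB', ?_, ?_, ?_⟩
    · simpa using ⟨h0, h0'⟩
    · simpa using ⟨ha, ha'⟩
    · have e := (IsFractionRing.injective (MvPolynomial ι ℂ) (FractionRing (MvPolynomial ι ℂ))).ne h0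
      have e' := (IsFractionRing.injective (MvPolynomial ι ℂ)
        (FractionRing (MvPolynomial ι ℂ))).ne h0'
      rw [map_zero] at e e'
      simp only [map_mul, map_add, AddMemClass.coe_add, hx, hy, div_add_div _ _ e e']
  algebraMap_mem' := by
    intro c
    refine ⟨0, C c, 1, isWeightedHomogeneous_C w c, isWeightedHomogeneous_one ℂ w, by simp,
      by simp, ?_⟩
    rw [map_one, map_one, div_one, aeval_C, ← IsScalarTower.algebraMap_apply]
    rfl

end Multiprojective

/-! ## Rational 4-forms -/

section Forms

variable {K K' : Type} [CommRing K] [CommRing K'] [Algebra ℂ K] [Algebra ℂ K']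

/-- Rational 4-forms on a variety with function field `K`. -/
abbrev RatForm (K : Type) [CommRing K] [Algebra ℂ K] : Type := ⋀[K]^4 Ω[K⁄ℂ]

instance (O : Subalgebra ℂ K) : Module O (RatForm K) := inferInstance

instance (O : Subalgebra ℂ K) : SMul O (RatForm K) := inferInstance

/-- The form `dg₁ ∧ dg₂ ∧ dg₃ ∧ dg₄`. -/
def dWedge (g : Fin 4 → K) : RatForm K :=
  exteriorPower.ιMulti K 4 fun i => KaehlerDifferential.D ℂ K (g i)

/-- The 4-forms that are regular at a point with local ring `O ⊆ K`, that is the image of the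
fourth exterior power of `Ω[O⁄ℂ]`: sums of `a dg₁ ∧ dg₂ ∧ dg₃ ∧ dg₄` with `a, gᵢ ∈ O`. -/
def regularForms (O : Subalgebra ℂ K) : Submodule O (RatForm K) :=
  Submodule.span O (Set.range fun g : Fin 4 → O => dWedge fun i => (g i : K))

/-- Near a point with local ring `O`, the form `ω` has at most a pole of order `n` along the
hypersurface with (locally principal) ideal `I ⊆ O`. -/
def PoleOrderLE (O : Subalgebra ℂ K) (I : Ideal O) (n : ℕ) (ω : RatForm K) : Prop :=
  ∀ h ∈ I ^ n, h • ω ∈ regularForms O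

/-- Moreover its numerator `F = f ^ n ω`, for `f` a generator of `I`, is in `J ^ m` times the
regular forms. -/
def NumeratorMem (O : Subalgebra ℂ K) (I J : Ideal O) (n m : ℕ) (ω : RatForm K) : Prop :=
  ∀ h ∈ I ^ n, h • ω ∈ J ^ m • regularForms O

/-- The pullback of rational 4-forms induced by a pullback `φ` of rational functions:
`a dg₁ ∧ ⋯ ∧ dg₄ ↦ φ a d(φ g₁) ∧ ⋯ ∧ d(φ g₄)`. -/
def formPullback (φ : K →ₐ[ℂ] K') : RatForm K →ₛₗ[(φ : K →+* K')] RatForm K' :=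
  letI : Algebra K K' := (φ : K →+* K').toAlgebra
  letI : Module K (RatForm K') := Module.compHom _ (φ : K →+* K')
  haveI : IsScalarTower ℂ K K' := IsScalarTower.of_algebraMap_eq fun c => (φ.commutes c).symm
  let L : RatForm K →ₗ[K] RatForm K' := exteriorPower.alternatingMapLinearEquiv
    { toFun := fun v => exteriorPower.ιMulti K' 4 fun i => KaehlerDifferential.map ℂ ℂ K K' (v i)
      map_update_add' := by
        intro _ v i x y
        have h : ∀ z, (fun j => KaehlerDifferential.map ℂ ℂ K K' (Function.update v i z j)) =
            Function.update (fun j => KaehlerDifferential.map ℂ ℂ K K' (v j)) i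
              (KaehlerDifferential.map ℂ ℂ K K' z) := fun z => by
          funext j; by_cases hj : j = i
          · subst hj; simp
          · simp [hj]
        simp only [h, map_add, AlternatingMap.map_update_add]
      map_update_smul' := by
        intro _ v i c x
        have h : ∀ z, (fun j => KaehlerDifferential.map ℂ ℂ K K' (Function.update v i z j)) =
            Function.update (fun j => KaehlerDifferential.map ℂ ℂ K K' (v j)) i
              (KaehlerDifferential.map ℂ ℂ K K' z) := fun z => by
          funext j; by_cases hj : j = i
          · subst hj; simp
          · simp [hj]
        have e : KaehlerDifferential.map ℂ ℂ K K' (c • x) =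
            (φ c) • KaehlerDifferential.map ℂ ℂ K K' x := by
          rw [map_smul, ← algebraMap_smul K' c]; rfl
        simp only [h, e, AlternatingMap.map_update_smul]
        rfl
      map_eq_zero_of_eq' := by
        intro v i j hv hij
        exact AlternatingMap.map_eq_zero_of_eq _ _ (by simp [hv]) hij }
  { toFun := L
    map_add' := L.map_add
    map_smul' := fun c x => L.map_smul c x }

theorem formPullback_dWedge (φ : K →ₐ[ℂ] K') (g : Fin 4 → K) :
    formPullback φ (dWedge g) = dWedge fun i => φ (g i) := by
  let : Algebra K K' := (φ : K →+* K').toAlgebra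
  let : Module K (RatForm K') := Module.compHom _ (φ : K →+* K')
  have : IsScalarTower ℂ K K' := IsScalarTower.of_algebraMap_eq fun c => (φ.commutes c).symm
  unfold dWedge
  refine (exteriorPower.alternatingMapLinearEquiv_apply_ιMulti _ _).trans ?_
  change exteriorPower.ιMulti K' 4 (fun i => KaehlerDifferential.map ℂ ℂ K K' _) = _
  simp only [KaehlerDifferential.map_D]
  rfl

end Forms

/-- The saturation `(I : E ^ ∞)`. -/
def saturation {K : Type} [CommRing K] [Algebra ℂ K] {O : Subalgebra ℂ K} (I E : Ideal O) :
    Ideal O where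
  carrier := {h | ∃ k : ℕ, ∀ e ∈ E ^ k, e * h ∈ I}
  zero_mem' := ⟨0, fun e _ => by simp⟩
  add_mem' := by
    rintro a b ⟨k, hk⟩ ⟨l, hl⟩
    refine ⟨k + l, fun e he => ?_⟩
    rw [mul_add]
    exact I.add_mem (hk e (Ideal.pow_le_pow_right (Nat.le_add_right k l) he))
      (hl e (Ideal.pow_le_pow_right (Nat.le_add_left l k) he))
  smul_mem' := by
    rintro c a ⟨k, hk⟩
    refine ⟨k, fun e he => ?_⟩
    rw [smul_eq_mul, mul_left_comm]
    exact I.mul_mem_left c (hk e he)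

/-! ## Projective 4-space and hypersurfaces -/

/-- Complex projective 4-space. -/
abbrev P4 : Type := ℙ ℂ (Fin 5 → ℂ)

/-- Zariski open subsets of projective 4-space. -/
def IsZariskiOpen (U : Set P4) : Prop :=
  ∃ T : Set (MvPolynomial (Fin 5) ℂ), (∀ h ∈ T, ∃ k, h.IsHomogeneous k) ∧
    U = {x | ∃ h ∈ T, eval x.rep h ≠ 0}

/-- The singular points of the hypersurface `f = 0`. -/
def singularLocus (f : MvPolynomial (Fin 5) ℂ) : Set P4 :=
  {x | eval x.rep f = 0 ∧ ∀ i, eval x.rep (pderiv i f) = 0}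

/-- A node (ordinary double point): a singular point at which the tangent cone is a nondegenerate
quadratic cone.  The `5 × 5` Hessian matrix at a singular point `x` has `x` in its kernel, and it
induces the Hessian form of a local equation on the 4-dimensional tangent space; the latter is
nondegenerate iff the rank is `4`. -/
def IsNode (f : MvPolynomial (Fin 5) ℂ) (x : P4) : Prop :=
  x ∈ singularLocus f ∧
    (Matrix.of fun i j : Fin 5 => eval x.rep (pderiv i (pderiv j f))).rank = 4

/-- The function field of projective 4-space. -/
abbrev KP : Subalgebra ℂ (FractionRing (MvPolynomial (Fin 5) ℂ)) :=
  functionField (fun _ : Fin 5 => (1 : ℕ)) X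

/-- The local ring of projective 4-space at `x`. -/
abbrev localRingP (x : P4) : Subalgebra ℂ KP :=
  localRing (fun _ : Fin 5 => (1 : ℕ)) X x.rep

/-- The maximal ideal of the local ring at `x`: fractions whose numerator vanishes at `x`. -/
def maxIdealP (x : P4) : Ideal (localRingP x) :=
  Ideal.span {g | ∃ (k : ℕ) (A B : MvPolynomial (Fin 5) ℂ), A.IsHomogeneous k ∧
    B.IsHomogeneous k ∧ eval x.rep B ≠ 0 ∧ eval x.rep A = 0 ∧
    ((g : KP) : FractionRing (MvPolynomial (Fin 5) ℂ)) = algebraMap _ _ A / algebraMap _ _ B}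

/-- The ideal of the hypersurface `f = 0` in the local ring at `x`: fractions whose numerator is
divisible by `f`. -/
def hypersurfaceIdeal (f : MvPolynomial (Fin 5) ℂ) (x : P4) : Ideal (localRingP x) :=
  Ideal.span {g | ∃ (k : ℕ) (A B : MvPolynomial (Fin 5) ℂ), A.IsHomogeneous k ∧
    B.IsHomogeneous k ∧ eval x.rep B ≠ 0 ∧ f ∣ A ∧
    ((g : KP) : FractionRing (MvPolynomial (Fin 5) ℂ)) = algebraMap _ _ A / algebraMap _ _ B}

/-- Sections over `U` of the sheaf of rational 4-forms with at most a pole of order `n` along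
`f = 0` and at least `m`-adjoint relative to the singular locus: at each singular point `p`, the
form `ω` is locally `F dz₁ ∧ dz₂ ∧ dz₃ ∧ dz₄ / f ^ n` with `F` of multiplicity at least `m`
at `p`, that is `F ∈ 𝔪_p ^ m`. -/
def adjointForms (f : MvPolynomial (Fin 5) ℂ) (n m : ℕ) (U : Set P4) : Set (RatForm KP) :=
  {ω | ∀ x ∈ U, PoleOrderLE (localRingP x) (hypersurfaceIdeal f x) n ω ∧
    (x ∈ singularLocus f →
      NumeratorMem (localRingP x) (hypersurfaceIdeal f x) (maxIdealP x) n m ω)}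

/-! ## The blow-up of projective 4-space along a finite set of points -/

/-- The linear map `y ↦ p ∧ y`, with kernel `ℂ p`; if `y ∉ ℂ p` these are the Plücker coordinates
of the line through `p` and `y`. -/
def joinMap (p : Fin 5 → ℂ) : (Fin 5 → ℂ) →ₗ[ℂ] (Fin 5 × Fin 5 → ℂ) where
  toFun y := fun ij => p ij.1 * y ij.2 - p ij.2 * y ij.1
  map_add' y z := by ext; simp; ring
  map_smul' c y := by ext; simp; ring

/-- The blow-up of projective 4-space along the set `S` of points: the pairs `(x, ξ)` of a point `x`
and, for every `p ∈ S`, a line `ξ p` through `p` that contains `x`.  The lines through `p` form the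
projective 3-space `ℙ(ℂ⁵ / ℂ p) = ℙ(range (p ∧ ·))`, and the incidence condition is that `p ∧ x` and
`ξ p` are proportional, so this is the fibre product over `ℙ⁴` of the
blow-ups `{(z, ξ) | zᵢ ξⱼ = zⱼ ξᵢ}` at the points of `S`. -/
def BlowUp (S : Set P4) : Type :=
  {q : P4 × (S → ℙ ℂ (Fin 5 × Fin 5 → ℂ)) //
    ∀ p : S, (q.2 p).submodule ≤ LinearMap.range (joinMap p.1.rep) ∧
      joinMap p.1.rep q.1.rep ∈ (q.2 p).submodule}

variable {S : Set P4}

/-- The blow-down map. -/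
def BlowUp.proj (q : BlowUp S) : P4 := q.1.1

/-- The exceptional divisor. -/
def BlowUp.exceptional (S : Set P4) : Set (BlowUp S) := {q | q.proj ∈ S}

/-- Indices of the multihomogeneous coordinates `y` and `ξ p`, `p ∈ S`, on the blow-up. -/
abbrev BlowUp.Coord (S : Set P4) : Type := Fin 5 ⊕ (S × (Fin 5 × Fin 5))

/-- Multidegrees of the coordinates: one degree for `y` and one for each `ξ p`. -/
def BlowUp.weight (S : Set P4) : BlowUp.Coord S → (Option S →₀ ℕ) :=
  Sum.elim (fun _ => Finsupp.single none 1) (fun pj => Finsupp.single (some pj.1) 1)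

/-- The generic point `(y, (p ∧ y)_p)` of the blow-up. -/
def BlowUp.generic (S : Set P4) : BlowUp.Coord S → MvPolynomial (Fin 5) ℂ :=
  Sum.elim X fun pj => C (pj.1.1.rep pj.2.1) * X pj.2.2 - C (pj.1.1.rep pj.2.2) * X pj.2.1

/-- Multihomogeneous coordinates of a point of the blow-up. -/
def BlowUp.coords (q : BlowUp S) : BlowUp.Coord S → ℂ :=
  Sum.elim q.1.1.rep fun pj => (q.1.2 pj.1).rep pj.2

/-- The function field of the blow-up. -/
abbrev KBl (S : Set P4) : Subalgebra ℂ (FractionRing (MvPolynomial (Fin 5) ℂ)) :=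
  functionField (BlowUp.weight S) (BlowUp.generic S)

/-- The local ring of the blow-up at `q`. -/
abbrev localRingBl (q : BlowUp S) : Subalgebra ℂ (KBl S) :=
  localRing (BlowUp.weight S) (BlowUp.generic S) q.coords

theorem BlowUp.isWeightedHomogeneous_rename {A : MvPolynomial (Fin 5) ℂ} {k : ℕ}
    (hA : IsWeightedHomogeneous (fun _ : Fin 5 => (1 : ℕ)) A k) :
    IsWeightedHomogeneous (BlowUp.weight S) (rename Sum.inl A) (Finsupp.single none k) := by
  intro d hd
  obtain ⟨u, rfl, hu⟩ := coeff_rename_ne_zero _ _ _ hd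
  have h := hA hu
  rw [Finsupp.weight_apply] at h ⊢
  rw [Finsupp.sum_mapDomain_index (by simp) (by intros; rw [add_smul]), ← h]
  simp [BlowUp.weight, Finsupp.sum, Finsupp.single_finsetSum]

theorem KP_le_KBl (S : Set P4) : KP ≤ KBl S := by
  rintro _ ⟨k, A, B, hA, hB, h0, rfl⟩
  have e : ∀ P : MvPolynomial (Fin 5) ℂ,
      aeval (BlowUp.generic S) (rename Sum.inl P) = aeval X P := fun P => by
    rw [aeval_rename]; rfl
  exact ⟨_, rename Sum.inl A, rename Sum.inl B, BlowUp.isWeightedHomogeneous_rename hA,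
    BlowUp.isWeightedHomogeneous_rename hB, by rwa [e], by rw [e, e]⟩

/-- Pullback of rational functions along the blow-down map `(y, ξ) ↦ y`. -/
def pullbackFun (S : Set P4) : KP →ₐ[ℂ] KBl S := Subalgebra.inclusion (KP_le_KBl S)

/-- Pullback of rational 4-forms along the blow-down map. -/
def pullbackForm (S : Set P4) : RatForm KP →ₛₗ[(pullbackFun S : KP →+* KBl S)] RatForm (KBl S) :=
  formPullback (pullbackFun S)

/-- Pullback of germs of regular functions along the blow-down map. -/
def pullbackGerm (q : BlowUp S) : localRingP q.proj →ₐ[ℂ] localRingBl q :=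
  ((pullbackFun S).comp (localRingP q.proj).val).codRestrict (localRingBl q) (by
    rintro ⟨g, k, A, B, hA, hB, h0, hb, hg⟩
    have e : ∀ P : MvPolynomial (Fin 5) ℂ,
        aeval (BlowUp.generic S) (rename Sum.inl P) = aeval X P := fun P => by
      rw [aeval_rename]; rfl
    refine ⟨_, rename Sum.inl A, rename Sum.inl B, BlowUp.isWeightedHomogeneous_rename hA,
      BlowUp.isWeightedHomogeneous_rename hB, by rwa [e], ?_, ?_⟩
    · rw [eval_rename]; exact hb
    · rw [e, e]; exact hg)

open Classical in
/-- The ideal of the exceptional divisor in the local ring at `q`: the inverse image ideal of the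
ideal of the reduced centre `S`. -/
def exceptionalIdeal (q : BlowUp S) : Ideal (localRingBl q) :=
  if q.proj ∈ S then (maxIdealP q.proj).map (pullbackGerm q) else ⊤

/-- The ideal at `q` of the total transform of the hypersurface `f = 0`. -/
def totalTransformIdeal (f : MvPolynomial (Fin 5) ℂ) (q : BlowUp S) : Ideal (localRingBl q) :=
  (hypersurfaceIdeal f q.proj).map (pullbackGerm q)

/-- The ideal at `q` of the strict transform of the hypersurface `f = 0`, that is of the closure of
the part of the total transform off the exceptional divisor: the saturation of the ideal of the
total transform by the ideal of the exceptional divisor. -/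
def strictTransformIdeal (f : MvPolynomial (Fin 5) ℂ) (q : BlowUp S) : Ideal (localRingBl q) :=
  saturation (totalTransformIdeal f q) (exceptionalIdeal q)

/-- The strict transform of the hypersurface `f = 0`, as a set of points. -/
def strictTransform (f : MvPolynomial (Fin 5) ℂ) (S : Set P4) : Set (BlowUp S) :=
  {q | strictTransformIdeal f q ≠ ⊤}

/-- Sections over `W` of the sheaf of rational 4-forms on the blow-up that have at most a pole of
order `n` along the strict transform of `f = 0`, and no other pole. -/
def strictTransformForms (f : MvPolynomial (Fin 5) ℂ) (S : Set P4) (n : ℕ) (W : Set (BlowUp S)) :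
    Set (RatForm (KBl S)) :=
  {ω | ∀ q ∈ W, PoleOrderLE (localRingBl q) (strictTransformIdeal f q) n ω}

end NodalForms

end

/-!
The question is local on the blow-up. Off the centre `Σ` the strict and the total transform agree,
and the claim is that pullback preserves regular forms (`PoleOrderLE.formPullback`).

At a point `q` over `p ∈ Σ` let `e` be a local equation of the exceptional divisor and `g` a local
equation of `f = 0` at `p`. Three counts along `e = 0` are compared.

* A germ at `p` pulls back to `c + e h` with `c` constant, so that `dg ↦ e dh + h de`, and a product
  of four such differentials is divisible by `e ^ 3` because `de ∧ de = 0`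
  (`dWedge_const_add_mul`). No local coordinates are needed.
* The numerator `F ∈ 𝔪_p ^ m` pulls back into `(e ^ m)`
  (`formPullback_pow_smul_regularForms`).
* As `p` is a node, `e ^ 3` does not divide the pullback of `g`, so that a section `s` of the ideal
  of the strict transform satisfies `g ∣ e ^ 2 s`
  (`BlowUp.IsChart.dvd_sq_mul_of_mem_strictTransformIdeal`).

Hence, for `s` in the `n`-th power of that ideal, `e ^ (2 n) s ω` is `e ^ (m + 3)` times a regular
form, and `2 n ≤ m + 3` gives that `s ω` is regular
(`poleOrderLE_formPullback_of_numerator`).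

The third count uses that `e` is prime in the local ring at `q`
(`BlowUp.IsChart.prime_excEq`). This is seen by restricting to the pencil of lines `y = p + t y'`
through `p`: the coordinates `p ∧ y` of the direction become `t (p ∧ y')`, a germ at `q` becomes a
fraction of polynomials in `t` and `y'` whose denominator is prime to `t`, and it is divisible by
`e` once `t` divides the numerator (`BlowUp.IsChart.exists_lineField_mul`). Primality of `e` is thereby
reduced to that of the variable `t`, and `e ^ 3 ∣ g` would give `t ^ 3 ∣ f (p + t y')`, which forces
the Hessian of `f` at `p` to vanish. The direction coordinates at the other points of `Σ` are
determined at `q` by `p` up to a nonzero factor, so that finiteness of `Σ` plays no role.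
-/

noncomputable section

namespace NodalForms

/-! ### Regular forms under pullback -/

section FormLemmas

variable {K K' : Type} [CommRing K] [CommRing K'] [Algebra ℂ K] [Algebra ℂ K']

theorem coe_smul_ratForm {O : Subalgebra ℂ K} (h : O) (ω : RatForm K) : h • ω = (h : K) • ω := rfl

theorem dWedge_mem_regularForms {O : Subalgebra ℂ K} {g : Fin 4 → K} (hg : ∀ i, g i ∈ O) :
    dWedge g ∈ regularForms O :=
  Submodule.subset_span ⟨fun i => ⟨g i, hg i⟩, rfl⟩

theorem formPullback_mem_regularForms {O : Subalgebra ℂ K} {O' : Subalgebra ℂ K'}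
    (φ : K →ₐ[ℂ] K') (hφ : ∀ g ∈ O, φ g ∈ O') {ω : RatForm K} (hω : ω ∈ regularForms O) :
    formPullback φ ω ∈ regularForms O' := by
  induction hω using Submodule.span_induction with
  | mem x hx =>
    obtain ⟨g, rfl⟩ := hx
    rw [formPullback_dWedge]
    exact dWedge_mem_regularForms fun i => hφ _ (g i).2
  | zero => rw [map_zero]; exact zero_mem _
  | add x y _ _ hx hy => rw [map_add]; exact add_mem hx hy
  | smul a x _ hx =>
    rw [coe_smul_ratForm, LinearMap.map_smulₛₗ]
    exact (regularForms O').smul_mem ⟨φ a, hφ _ a.2⟩ hx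

/-- If `gᵢ = cᵢ + e hᵢ` with `cᵢ` constant, then `dgᵢ = e dhᵢ + hᵢ de`; as `de ∧ de = 0`, at most
one factor of `dg₁ ∧ ⋯ ∧ dg₄` contributes its second term, so that the product is divisible by
`e ^ 3`. -/
theorem dWedge_const_add_mul {O : Subalgebra ℂ K} (e : O) (c : Fin 4 → ℂ) (h : Fin 4 → O) :
    ∃ r ∈ regularForms O,
      dWedge (fun i => algebraMap ℂ K (c i) + (e : K) * (h i : K)) = (e : K) ^ 3 • r := by
  have key : ∀ s : Finset (Fin 4), ∃ r ∈ regularForms O,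
      exteriorPower.ιMulti K 4 (s.piecewise
        (fun i => (e : K) • KaehlerDifferential.D ℂ K (h i : K))
        (fun i => (h i : K) • KaehlerDifferential.D ℂ K (e : K))) = (e : K) ^ 3 • r := by
    intro s
    have e1 : s.piecewise
        (fun i => (e : K) • KaehlerDifferential.D ℂ K (h i : K))
        (fun i => (h i : K) • KaehlerDifferential.D ℂ K (e : K)) =
        fun i => ((if i ∈ s then e else h i : O) : K) •
          KaehlerDifferential.D ℂ K (if i ∈ s then h i else e : O) := by
      funext i
      by_cases hi : i ∈ s <;> simp [hi]
    rw [e1, ← AlternatingMap.coe_multilinearMap, MultilinearMap.map_smul_univ,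
      AlternatingMap.coe_multilinearMap]
    -- The factors outside `s` are all `de`.
    by_cases hs : 2 ≤ sᶜ.card
    · obtain ⟨i, hi, j, hj, hij⟩ := Finset.one_lt_card.1 hs
      rw [Finset.mem_compl] at hi hj
      refine ⟨0, zero_mem _, ?_⟩
      rw [AlternatingMap.map_eq_zero_of_eq _ _ (by simp [hi, hj]) hij, smul_zero, smul_zero]
    · have hs3 : 3 ≤ s.card := by
        have := Finset.card_compl_add_card s
        rw [Fintype.card_fin] at this
        omega
      refine ⟨(e ^ (s.card - 3) * ∏ i ∈ sᶜ, h i) •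
          dWedge fun i => ((if i ∈ s then h i else e : O) : K),
        Submodule.smul_mem _ _ (dWedge_mem_regularForms fun i => Subtype.prop _), ?_⟩
      rw [coe_smul_ratForm, smul_smul]
      congr 1
      rw [← Finset.prod_mul_prod_compl s, Finset.prod_congr rfl (g := fun _ => (e : K))
        (fun i hi => by simp [hi]), Finset.prod_const, Finset.prod_congr rfl (s₁ := sᶜ)
        (g := fun i => (h i : K)) (fun i hi => by simp [Finset.mem_compl.1 hi])]
      push_cast
      rw [← mul_assoc, ← pow_add, Nat.add_sub_cancel' hs3]
  choose r hr hr' using key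
  refine ⟨∑ s, r s, sum_mem fun s _ => hr s, ?_⟩
  have e2 : (fun i => KaehlerDifferential.D ℂ K (algebraMap ℂ K (c i) + (e : K) * (h i : K))) =
      (fun i => (e : K) • KaehlerDifferential.D ℂ K (h i : K)) +
        (fun i => (h i : K) • KaehlerDifferential.D ℂ K (e : K)) := by
    funext i
    simp [Derivation.leibniz]
  rw [dWedge, e2, ← AlternatingMap.coe_multilinearMap, MultilinearMap.map_add_univ,
    Finset.smul_sum]
  exact Finset.sum_congr rfl fun s _ => hr' s

/-- Regular forms gain a factor `e ^ 3` under the pullback if every pulled back germ is a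
constant modulo `e`. -/
theorem formPullback_regularForms_eq_pow_smul {O : Subalgebra ℂ K} {O' : Subalgebra ℂ K'}
    (φ : K →ₐ[ℂ] K') (e : O')
    (hφ : ∀ g ∈ O, ∃ (c : ℂ) (h : O'), φ g = algebraMap ℂ K' c + (e : K') * (h : K'))
    {ω : RatForm K} (hω : ω ∈ regularForms O) :
    ∃ r ∈ regularForms O', formPullback φ ω = (e : K') ^ 3 • r := by
  induction hω using Submodule.span_induction with
  | mem x hx =>
    obtain ⟨g, rfl⟩ := hx
    rw [formPullback_dWedge]
    choose c h hch using fun i => hφ _ (g i).2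
    simp only [hch]
    exact dWedge_const_add_mul e c h
  | zero => exact ⟨0, zero_mem _, by simp⟩
  | add x y _ _ hx hy =>
    obtain ⟨r, hr, er⟩ := hx
    obtain ⟨s, hs, es⟩ := hy
    exact ⟨r + s, add_mem hr hs, by rw [map_add, er, es, smul_add]⟩
  | smul a x _ hx =>
    obtain ⟨r, hr, er⟩ := hx
    obtain ⟨c, h, hch⟩ := hφ _ a.2
    refine ⟨(algebraMap ℂ O' c + e * h) • r, Submodule.smul_mem _ _ hr, ?_⟩
    rw [coe_smul_ratForm, LinearMap.map_smulₛₗ, er, coe_smul_ratForm, smul_comm]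
    congr 2

/-- A numerator in `J ^ m` contributes a further factor `e ^ m` if `J` pulls back into `(e)`. -/
theorem formPullback_pow_smul_regularForms {O : Subalgebra ℂ K} {O' : Subalgebra ℂ K'}
    (φ : K →ₐ[ℂ] K') (γ : O →+* O') (hγ : ∀ g : O, (γ g : K') = φ g) (e : O') (J : Ideal O)
    (hφ : ∀ g : O, ∃ c : ℂ, e ∣ γ g - algebraMap ℂ O' c) (hJ : ∀ g ∈ J, e ∣ γ g) (m : ℕ)
    {ω : RatForm K} (hω : ω ∈ J ^ m • regularForms O) :
    ∃ r ∈ regularForms O', formPullback φ ω = (e : K') ^ (m + 3) • r := by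
  have hJm : J ^ m ≤ ((Ideal.span {e}) ^ m).comap γ :=
    (Ideal.pow_right_mono (fun g hg => by
      rw [Ideal.mem_comap, Ideal.mem_span_singleton]; exact hJ g hg) m).trans
      (Ideal.le_comap_pow γ m)
  have hφ' : ∀ g ∈ O, ∃ (c : ℂ) (h : O'), φ g = algebraMap ℂ K' c + (e : K') * (h : K') := by
    intro g hg
    obtain ⟨c, h, hch⟩ := hφ ⟨g, hg⟩
    refine ⟨c, h, ?_⟩
    have := congrArg (fun x : O' => (x : K')) (sub_eq_iff_eq_add'.1 hch)
    simpa [hγ] using this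
  refine Submodule.smul_induction_on (p := fun ω => ∃ r ∈ regularForms O',
    formPullback φ ω = (e : K') ^ (m + 3) • r) hω ?_ ?_
  · intro a ha x hx
    obtain ⟨r, hr, er⟩ := formPullback_regularForms_eq_pow_smul φ e hφ' hx
    have h1 := hJm ha
    rw [Ideal.mem_comap, Ideal.span_singleton_pow, Ideal.mem_span_singleton] at h1
    obtain ⟨b, hb⟩ := h1
    refine ⟨b • r, Submodule.smul_mem _ _ hr, ?_⟩
    rw [coe_smul_ratForm, LinearMap.map_smulₛₗ, er, coe_smul_ratForm, smul_smul, smul_smul]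
    congr 1
    change φ a * _ = _
    rw [← hγ, hb]
    push_cast
    ring
  · intro x y hx hy
    obtain ⟨r, hr, er⟩ := hx
    obtain ⟨s, hs, es⟩ := hy
    exact ⟨r + s, add_mem hr hs, by rw [map_add, er, es, smul_add]⟩

theorem PoleOrderLE.mem_regularForms {O : Subalgebra ℂ K} {n : ℕ} {ω : RatForm K}
    (h : PoleOrderLE O ⊤ n ω) : ω ∈ regularForms O := by
  have h1 := h 1 (by rw [Ideal.top_pow]; exact Submodule.mem_top)
  rwa [one_smul] at h1

theorem PoleOrderLE.formPullback {O : Subalgebra ℂ K} {O' : Subalgebra ℂ K'}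
    (φ : K →ₐ[ℂ] K') (γ : O →+* O') (hγ : ∀ g : O, (γ g : K') = φ g) {I : Ideal O} {I' : Ideal O'}
    (hI : I' ≤ I.map γ) {n : ℕ} {ω : RatForm K} (hω : PoleOrderLE O I n ω) :
    PoleOrderLE O' I' n (formPullback φ ω) := by
  intro s hs
  have hs' := Ideal.pow_right_mono hI n hs
  rw [← Ideal.map_pow] at hs'
  clear hs
  induction hs' using Submodule.span_induction with
  | mem x hx =>
    obtain ⟨g, hg, rfl⟩ := hx
    have := formPullback_mem_regularForms (O' := O') φ
      (fun g hg => by rw [← hγ ⟨g, hg⟩]; exact (γ ⟨g, hg⟩).2) (hω g hg)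
    rw [coe_smul_ratForm, LinearMap.map_smulₛₗ] at this
    rw [coe_smul_ratForm, hγ]
    exact this
  | zero => rw [zero_smul]; exact zero_mem _
  | add x y _ _ hx hy => rw [add_smul]; exact add_mem hx hy
  | smul a x _ hx => rw [smul_assoc]; exact Submodule.smul_mem _ _ hx

/-- If a strict transform ideal `I'` satisfies `e ^ 2 I' ⊆ (g)`, then `n` poles along `g = 0`
contribute at most `2 n` poles along `e = 0`; they are compensated by the `m` zeros of the numerator
and the `3` zeros of the pulled back canonical form. -/
theorem poleOrderLE_formPullback_of_numerator {O : Subalgebra ℂ K} {O' : Subalgebra ℂ K'}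
    (φ : K →ₐ[ℂ] K') (γ : O →+* O') (hγ : ∀ g : O, (γ g : K') = φ g) (e : O')
    (he : IsUnit (e : K')) (J : Ideal O)
    (hφ : ∀ g : O, ∃ c : ℂ, e ∣ γ g - algebraMap ℂ O' c) (hJ : ∀ g ∈ J, e ∣ γ g) {g : O}
    {I' : Ideal O'} (hI' : ∀ s ∈ I', γ g ∣ e ^ 2 * s) {n m : ℕ} (hnm : 2 * n ≤ m + 3)
    {ω : RatForm K} (hω : g ^ n • ω ∈ J ^ m • regularForms O) :
    PoleOrderLE O' I' n (formPullback φ ω) := by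
  obtain ⟨r, hr, hgr⟩ := formPullback_pow_smul_regularForms φ γ hγ e J hφ hJ m hω
  intro s hs
  have hle : Ideal.span {e ^ 2} * I' ≤ Ideal.span {γ g} := by
    rw [Ideal.mul_le]
    intro a ha b hb
    obtain ⟨a, rfl⟩ := Ideal.mem_span_singleton.1 ha
    rw [Ideal.mem_span_singleton, mul_right_comm]
    exact (hI' b hb).mul_right a
  have hs' : (e ^ 2) ^ n * s ∈ Ideal.span {γ g} ^ n := Ideal.pow_right_mono hle n (by
    rw [mul_pow, Ideal.span_singleton_pow]
    exact Ideal.mul_mem_mul (Ideal.mem_span_singleton_self _) hs)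
  rw [Ideal.span_singleton_pow, Ideal.mem_span_singleton, ← pow_mul] at hs'
  obtain ⟨a, ha⟩ := hs'
  -- Both sides agree after multiplication by `e ^ (2 n)`, a unit of the function field.
  have key : s • formPullback φ ω = (a * e ^ (m + 3 - 2 * n)) • r := by
    rw [← (he.pow (2 * n)).smul_left_cancel]
    have hgr' : (γ g : K') ^ n • formPullback φ ω = (e : K') ^ (m + 3) • r := by
      rw [← hgr, coe_smul_ratForm, LinearMap.map_smulₛₗ, hγ]
      congr 1
      exact (map_pow φ _ _).symm
    have ha' := congrArg (fun x : O' => (x : K')) ha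
    push_cast at ha'
    rw [coe_smul_ratForm, coe_smul_ratForm, smul_smul, ha', mul_comm, mul_smul, hgr', smul_smul,
      smul_smul]
    congr 1
    push_cast
    rw [mul_left_comm, ← pow_add, Nat.add_sub_cancel' hnm]
  rw [key]
  exact Submodule.smul_mem _ _ hr

end FormLemmas

/-! ### Weighted homogeneous polynomials -/

section Weighted

variable {σ M : Type} [AddCommMonoid M]

/-- Rescaling the coordinates through a character `χ` of the grading monoid multiplies a weighted
homogeneous polynomial of degree `k` by `χ k`. -/
theorem aeval_mul_char {R : Type} [CommRing R] [Algebra ℂ R] {w : σ → M} {A : MvPolynomial σ ℂ}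
    {k : M} (hA : IsWeightedHomogeneous w A k) (χ : Multiplicative M →* R) (x : σ → R) :
    aeval (fun j => χ (.ofAdd (w j)) * x j) A = χ (.ofAdd k) * aeval x A := by
  rw [aeval_def, aeval_def, eval₂_eq, eval₂_eq, Finset.mul_sum]
  refine Finset.sum_congr rfl fun d hd => ?_
  have h := hA (mem_support_iff.1 hd)
  rw [Finsupp.weight_apply, Finsupp.sum] at h
  rw [Finset.prod_congr rfl fun i _ => mul_pow _ _ _, Finset.prod_mul_distrib,
    ← h, ofAdd_sum, map_prod]
  simp only [ofAdd_nsmul, map_pow]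
  ring

/-- The character `k ↦ ∏ s, c s ^ k s` of `σ →₀ ℕ`. -/
def powChar {R : Type} [CommRing R] (c : σ → R) : Multiplicative (σ →₀ ℕ) →* R where
  toFun k := (Multiplicative.toAdd k).prod fun s n => c s ^ n
  map_one' := Finsupp.prod_zero_index
  map_mul' k l := by
    classical
    exact Finsupp.prod_add_index' (fun _ => pow_zero _) (fun _ _ _ => pow_add _ _ _)

theorem powChar_single {R : Type} [CommRing R] (c : σ → R) (s : σ) :
    powChar c (.ofAdd (Finsupp.single s 1)) = c s := by
  change (Finsupp.single s 1).prod _ = _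
  simp [Finsupp.prod_single_index]

theorem powChar_ne_zero {R : Type} [CommRing R] [IsDomain R] {c : σ → R} (hc : ∀ s, c s ≠ 0)
    (k : Multiplicative (σ →₀ ℕ)) : powChar c k ≠ 0 :=
  Finset.prod_ne_zero_iff.2 fun s _ => pow_ne_zero _ (hc s)

/-- A homogeneous multiple of a homogeneous polynomial has a homogeneous cofactor, which may have
to be taken to be zero. -/
theorem exists_isHomogeneous_cofactor {f A : MvPolynomial σ ℂ} {d k : ℕ}
    (hf : f.IsHomogeneous d) (hA : A.IsHomogeneous k) (h : f ∣ A) :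
    A = 0 ∨ ∃ (l : ℕ) (C : MvPolynomial σ ℂ), C.IsHomogeneous l ∧ k = d + l ∧ A = f * C := by
  classical
  let : GradedAlgebra (homogeneousSubmodule σ ℂ) := MvPolynomial.gradedAlgebra
  obtain ⟨C, rfl⟩ := h
  have hA' : (DirectSum.decompose (homogeneousSubmodule σ ℂ) (f * C) k :
      MvPolynomial σ ℂ) = f * C :=
    DirectSum.decompose_of_mem_same _ hA
  by_cases hdk : d ≤ k
  · obtain ⟨l, rfl⟩ := Nat.exists_eq_add_of_le hdk
    right
    rw [DirectSum.coe_decompose_mul_add_of_left_mem (homogeneousSubmodule σ ℂ) hf] at hA'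
    exact ⟨l, _, (DirectSum.decompose (homogeneousSubmodule σ ℂ) C l).2, rfl, hA'.symm⟩
  · left
    rw [← hA', DirectSum.coe_decompose_mul_of_left_mem_of_not_le (homogeneousSubmodule σ ℂ) hf hdk]

end Weighted

/-! ### Divisibility and saturation -/

theorem dvd_of_dvd_sub_algebraMap {O : Type} [CommRing O] [Algebra ℂ O] {e x : O} {c : ℂ}
    (h : e ∣ x - algebraMap ℂ O c) (hc : c = 0) : e ∣ x := by
  rwa [hc, map_zero, sub_zero] at h

/-- In a domain, if `e` is prime and `e ^ 3` does not divide `g`, the saturation of `(g)` by `e` is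
contained in `(g) : e ^ 2`. -/
theorem dvd_sq_mul_of_dvd_pow_mul {R : Type*} [CommRing R] [IsDomain R] {e g s : R} (he : Prime e)
    (hg : ¬ e ^ 3 ∣ g) {k : ℕ} (h : g ∣ e ^ k * s) : g ∣ e ^ 2 * s := by
  by_cases hk : k ≤ 2
  · exact h.trans (mul_dvd_mul_right (pow_dvd_pow e hk) s)
  have hfin : FiniteMultiplicity e g := ⟨2, hg⟩
  obtain ⟨c, hc, hec⟩ := hfin.exists_eq_pow_mul_and_not_dvd
  set j := multiplicity e g
  have hj : j ≤ 2 := by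
    by_contra hj
    exact hg ((pow_dvd_pow e (by omega)).trans ⟨c, hc⟩)
  obtain ⟨a, ha⟩ := h
  rw [hc, ← Nat.add_sub_of_le (by omega : j ≤ k), pow_add, mul_assoc, mul_assoc] at ha
  have ha' := mul_left_cancel₀ (pow_ne_zero j he.ne_zero) ha
  obtain ⟨b, rfl⟩ := he.pow_dvd_of_dvd_mul_left (k - j) hec ⟨s, ha'.symm⟩
  have hs : s = c * b := mul_left_cancel₀ (pow_ne_zero (k - j) he.ne_zero) (by rw [ha']; ring)
  rw [hc, hs, ← Nat.add_sub_of_le hj, pow_add]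
  exact ⟨e ^ (2 - j) * b, by ring⟩

theorem dvd_sq_mul_of_mem_saturation {K : Type} [CommRing K] [Algebra ℂ K] {O : Subalgebra ℂ K}
    [IsDomain O] {I E : Ideal O} {e g s : O} (he : Prime e) (heE : e ∈ E) (hg : ¬ e ^ 3 ∣ g)
    (hI : I ≤ Ideal.span {g}) (hs : s ∈ saturation I E) : g ∣ e ^ 2 * s := by
  obtain ⟨k, hk⟩ := hs
  exact dvd_sq_mul_of_dvd_pow_mul he hg
    (Ideal.mem_span_singleton.1 (hI (hk _ (Ideal.pow_mem_pow heE k))))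

theorem map_le_span_singleton {K K' : Type} [CommRing K] [CommRing K'] [Algebra ℂ K]
    [Algebra ℂ K'] {O : Subalgebra ℂ K} {O' : Subalgebra ℂ K'} (γ : O →ₐ[ℂ] O')
    {I : Ideal O} {g : O} (h : I ≤ Ideal.span {g}) : I.map γ ≤ Ideal.span {γ g} :=
  Ideal.map_le_iff_le_comap.2 fun _ hy =>
    Ideal.mem_span_singleton.2 (map_dvd γ (Ideal.mem_span_singleton.1 (h hy)))

/-! ### Coordinates of a point of the exceptional divisor -/

section Points

variable {S : Set P4}

/-- Away from the centre `s`, the coordinates of the direction at `s` are determined by the base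
point. -/
theorem BlowUp.exists_join_eq (q : BlowUp S) (s : S) (hs : s.1 ≠ q.proj) :
    ∃ a : ℂ, a ≠ 0 ∧ ∀ ij, joinMap s.1.rep q.1.1.rep ij = a * (q.1.2 s).rep ij := by
  have h := (q.2 s).2
  rw [Projectivization.submodule_eq, Submodule.mem_span_singleton] at h
  obtain ⟨a, ha⟩ := h
  refine ⟨a, ?_, fun ij => by rw [← ha]; rfl⟩
  rintro rfl
  rw [zero_smul] at ha
  have h0 : ∀ i j, s.1.rep i * q.1.1.rep j = s.1.rep j * q.1.1.rep i := fun i j => by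
    have : s.1.rep i * q.1.1.rep j - s.1.rep j * q.1.1.rep i = 0 := (congrFun ha (i, j)).symm
    linear_combination this
  obtain ⟨i, hi⟩ := Function.ne_iff.1 s.1.rep_nonzero
  rw [Pi.zero_apply] at hi
  apply hs
  change s.1 = q.1.1
  rw [← s.1.mk_rep, ← q.1.1.mk_rep, Projectivization.mk_eq_mk_iff']
  have hq : q.1.1.rep i ≠ 0 := by
    intro hq
    apply q.1.1.rep_nonzero
    funext j
    have := h0 i j
    rw [hq, mul_zero] at this
    exact (mul_eq_zero.1 this).resolve_left hi
  refine ⟨s.1.rep i / q.1.1.rep i, ?_⟩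
  funext j
  rw [Pi.smul_apply, smul_eq_mul, div_mul_eq_mul_div, div_eq_iff hq]
  exact h0 i j

/-- The coordinates of the direction at the base point satisfy the incidence relations of
`p ∧ v`. -/
theorem BlowUp.direction_relation (q : BlowUp S) (hq : q.proj ∈ S) (i j k : Fin 5) :
    q.1.1.rep i * (q.1.2 ⟨q.proj, hq⟩).rep (k, j) - q.1.1.rep j * (q.1.2 ⟨q.proj, hq⟩).rep (k, i) =
      q.1.1.rep k * (q.1.2 ⟨q.proj, hq⟩).rep (i, j) := by
  have h := (q.2 ⟨q.proj, hq⟩).1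
  rw [Projectivization.submodule_eq, Submodule.span_singleton_le_iff_mem] at h
  obtain ⟨v, hv⟩ := h
  have h' : ∀ a b, (q.1.2 ⟨q.proj, hq⟩).rep (a, b) =
      q.1.1.rep a * v b - q.1.1.rep b * v a := fun a b => (congrFun hv (a, b)).symm
  rw [h', h', h']
  ring

/-- The indices `i₀`, `i₁` select an affine chart of the blow-up around the point `q` of the
exceptional divisor: the `i₀`-th coordinate of the base point and the `(i₀, i₁)`-th coordinate of
the direction do not vanish. -/
structure BlowUp.IsChart (q : BlowUp S) (hq : q.proj ∈ S) (i₀ i₁ : Fin 5) : Prop where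
  base_ne_zero : q.1.1.rep i₀ ≠ 0
  direction_ne_zero : (q.1.2 ⟨q.proj, hq⟩).rep (i₀, i₁) ≠ 0

theorem BlowUp.exists_isChart (q : BlowUp S) (hq : q.proj ∈ S) : ∃ i₀ i₁, q.IsChart hq i₀ i₁ := by
  obtain ⟨i, hi⟩ := Function.ne_iff.1 q.1.1.rep_nonzero
  rw [Pi.zero_apply] at hi
  by_contra! h
  have h0 : ∀ j, (q.1.2 ⟨q.proj, hq⟩).rep (i, j) = 0 := fun j => by
    by_contra hj
    exact h i j ⟨hi, hj⟩
  apply (q.1.2 ⟨q.proj, hq⟩).rep_nonzero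
  funext ⟨a, b⟩
  have := q.direction_relation hq a b i
  rw [h0, h0, mul_zero, mul_zero, sub_zero] at this
  exact (mul_eq_zero.1 this.symm).resolve_left hi

end Points

/-! ### The family of lines through the centre -/

section Lines

/-- The generic point `p + t y` of the pencil of lines through `p`; the variable `none` is `t` and
the variables `some i` are the coordinates of `y`. -/
def lineThrough (p : Fin 5 → ℂ) (i : Fin 5) : MvPolynomial (Option (Fin 5)) ℂ :=
  C (p i) + X none * X (some i)

theorem aeval_lineThrough_injective (p : Fin 5 → ℂ) :
    Function.Injective (aeval (R := ℂ) (lineThrough p)) := by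
  -- Setting `t = 1` and translating back by `p` gives a left inverse.
  let ψ : MvPolynomial (Option (Fin 5)) ℂ →ₐ[ℂ] MvPolynomial (Fin 5) ℂ :=
    aeval fun o => o.elim 1 fun i => X i - C (p i)
  have h : ψ.comp (aeval (lineThrough p)) = AlgHom.id ℂ _ := by
    ext i : 1
    simp [ψ, lineThrough, algebraMap_eq]
  intro a b hab
  simpa using (AlgHom.congr_fun h a).symm.trans ((congrArg ψ hab).trans (AlgHom.congr_fun h b))

theorem X_none_dvd_aeval_lineThrough_sub (p : Fin 5 → ℂ) (A : MvPolynomial (Fin 5) ℂ) :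
    X none ∣ aeval (lineThrough p) A - C (eval p A) := by
  let π := Ideal.Quotient.mkₐ ℂ (Ideal.span {(X none : MvPolynomial (Option (Fin 5)) ℂ)})
  have h : π.comp (aeval (lineThrough p)) = π.comp (aeval fun i => C (p i)) := by
    ext i : 1
    rw [AlgHom.comp_apply, AlgHom.comp_apply, aeval_X, aeval_X]
    refine Ideal.Quotient.eq.2 (Ideal.mem_span_singleton.2 ⟨X (some i), ?_⟩)
    rw [lineThrough, add_sub_cancel_left]
  have h2 : aeval (fun i => (C (p i) : MvPolynomial (Option (Fin 5)) ℂ)) A = C (eval p A) := by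
    rw [← coe_aeval_eq_eval]
    exact aeval_algebraMap_apply (MvPolynomial (Option (Fin 5)) ℂ) p A
  rw [← h2, ← Ideal.mem_span_singleton]
  exact Ideal.Quotient.eq.1 (AlgHom.congr_fun h A)

theorem pderiv_aeval_lineThrough (p : Fin 5 → ℂ) (i : Fin 5) (A : MvPolynomial (Fin 5) ℂ) :
    pderiv (some i) (aeval (lineThrough p) A) = X none * aeval (lineThrough p) (pderiv i A) := by
  induction A using MvPolynomial.induction_on with
  | C a => simp [algebraMap_eq]
  | add a b ha hb => simp only [map_add, ha, hb, mul_add]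
  | mul_X a j ha =>
    have hj : pderiv (some i) (lineThrough p j) =
        X none * aeval (lineThrough p) (pderiv i (X j : MvPolynomial (Fin 5) ℂ)) := by
      rw [lineThrough]
      by_cases hij : j = i
      · subst hij; simp [Derivation.leibniz]
      · simp [Derivation.leibniz, pderiv_X, hij]
    simp only [map_mul, Derivation.leibniz, map_add, aeval_X, ha, hj, smul_eq_mul]
    ring

/-- If `f` vanishes to order at least `3` at `p`, then all its second derivatives vanish
at `p`. -/
theorem eval_pderiv_pderiv_eq_zero {p : Fin 5 → ℂ} {f : MvPolynomial (Fin 5) ℂ}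
    (h : X none ^ 3 ∣ aeval (lineThrough p) f) (i j : Fin 5) :
    eval p (pderiv i (pderiv j f)) = 0 := by
  obtain ⟨G, hG⟩ := h
  have h1 := congrArg (fun F => pderiv (some i) (pderiv (some j) F)) hG
  have hX : ∀ k : Fin 5, ∀ H : MvPolynomial (Option (Fin 5)) ℂ, ∀ m,
      pderiv (some k) (X none ^ m * H) = X none ^ m * pderiv (some k) H := fun k H m => by
    simp [Derivation.leibniz, Derivation.leibniz_pow]
  have hX1 : ∀ k : Fin 5, ∀ H : MvPolynomial (Option (Fin 5)) ℂ,
      pderiv (some k) (X none * H) = X none * pderiv (some k) H := fun k H => by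
    simp [Derivation.leibniz]
  simp only [pderiv_aeval_lineThrough, hX, hX1] at h1
  have h2 : aeval (lineThrough p) (pderiv i (pderiv j f)) =
      X none * pderiv (some i) (pderiv (some j) G) := by
    apply mul_left_cancel₀ (pow_ne_zero 2 (X_ne_zero (R := ℂ) (none : Option (Fin 5))))
    linear_combination h1
  obtain ⟨H, hH⟩ := X_none_dvd_aeval_lineThrough_sub p (pderiv i (pderiv j f))
  have h3 := congrArg (eval fun _ => (0 : ℂ)) hH
  rw [h2] at h3
  simpa using h3

/-- The embedding of `ℂ(y)` into `ℂ(t, y)` given by `y ↦ p + t y`. -/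
def lineField (p : Fin 5 → ℂ) : FractionRing (MvPolynomial (Fin 5) ℂ) →+*
    FractionRing (MvPolynomial (Option (Fin 5)) ℂ) :=
  IsFractionRing.map (j := (aeval (R := ℂ) (lineThrough p)).toRingHom)
    (aeval_lineThrough_injective p)

theorem lineField_algebraMap (p : Fin 5 → ℂ) (A : MvPolynomial (Fin 5) ℂ) :
    lineField p (algebraMap _ _ A) = algebraMap _ _ (aeval (lineThrough p) A) := by
  rw [lineField, IsFractionRing.map, IsLocalization.map_eq]
  rfl

end Lines

/-! ### The affine chart of the blow-up at a point of the exceptional divisor -/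

section Chart

variable {S : Set P4}

theorem BlowUp.aeval_eq_powChar_mul {R : Type} [CommRing R] [Algebra ℂ R] (c : Option S → R)
    {x y : BlowUp.Coord S → R} (h₁ : ∀ i, y (.inl i) = c none * x (.inl i))
    (h₂ : ∀ s ij, y (.inr (s, ij)) = c (some s) * x (.inr (s, ij)))
    {A : MvPolynomial (BlowUp.Coord S) ℂ} {k : Option S →₀ ℕ}
    (hA : IsWeightedHomogeneous (BlowUp.weight S) A k) :
    aeval y A = powChar c (.ofAdd k) * aeval x A := by
  rw [← aeval_mul_char hA]
  congr 2
  funext j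
  rcases j with i | ⟨s, ij⟩
  · rw [h₁, BlowUp.weight, Sum.elim_inl, powChar_single]
  · rw [h₂, BlowUp.weight, Sum.elim_inr, powChar_single]

open Classical in
/-- The generic point of the blow-up, restricted along `y ↦ p + t y` with `p` the base point of `q`.
The coordinates `p ∧ (p + t y) = t (p ∧ y)` of the direction at `p` are divided by `t`. -/
def BlowUp.chartCoord (q : BlowUp S) : BlowUp.Coord S → MvPolynomial (Option (Fin 5)) ℂ :=
  Sum.elim (lineThrough q.1.1.rep) fun sj =>
    if sj.1.1 = q.proj then
      C (q.1.1.rep sj.2.1) * X (some sj.2.2) - C (q.1.1.rep sj.2.2) * X (some sj.2.1)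
    else
      C (sj.1.1.rep sj.2.1) * lineThrough q.1.1.rep sj.2.2 -
        C (sj.1.1.rep sj.2.2) * lineThrough q.1.1.rep sj.2.1

theorem BlowUp.chartCoord_inl (q : BlowUp S) (i : Fin 5) :
    q.chartCoord (.inl i) = lineThrough q.1.1.rep i := rfl

theorem BlowUp.chartCoord_inr_self (q : BlowUp S) {s : S} (hs : s.1 = q.proj) (i j : Fin 5) :
    q.chartCoord (.inr (s, (i, j))) =
      C (q.1.1.rep i) * X (some j) - C (q.1.1.rep j) * X (some i) := if_pos hs

theorem BlowUp.chartCoord_inr_of_ne (q : BlowUp S) {s : S} (hs : s.1 ≠ q.proj) (i j : Fin 5) :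
    q.chartCoord (.inr (s, (i, j))) =
      C (s.1.rep i) * lineThrough q.1.1.rep j - C (s.1.rep j) * lineThrough q.1.1.rep i := if_neg hs

open Classical in
/-- Restriction to the lines through the base point: the generic point acquires a factor `t` in the
direction coordinates at the base point. -/
theorem BlowUp.exists_aeval_lineThrough_generic (q : BlowUp S) (k : Option S →₀ ℕ) :
    ∃ c : MvPolynomial (Option (Fin 5)) ℂ, c ≠ 0 ∧ ∀ A : MvPolynomial (BlowUp.Coord S) ℂ,
      IsWeightedHomogeneous (BlowUp.weight S) A k →
        aeval (lineThrough q.1.1.rep) (aeval (BlowUp.generic S) A) = c * aeval q.chartCoord A := by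
  refine ⟨powChar (fun o => o.elim 1 fun s => if s.1 = q.proj then X none else 1) (.ofAdd k),
    powChar_ne_zero ?_ _, fun A hA => ?_⟩
  · rintro (_ | s)
    · exact one_ne_zero
    · change (if _ then _ else _) ≠ _
      split_ifs
      · exact X_ne_zero _
      · exact one_ne_zero
  · rw [← BlowUp.aeval_eq_powChar_mul (y := fun j => aeval (lineThrough q.1.1.rep)
      (BlowUp.generic S j)) _ ?_ ?_ hA]
    · rw [← AlgHom.comp_apply, comp_aeval]
    · intro i
      simp [BlowUp.generic, BlowUp.chartCoord_inl]
    · rintro s ⟨i, j⟩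
      by_cases hs : s.1 = q.proj
      · simp only [BlowUp.generic, Sum.elim_inr, q.chartCoord_inr_self hs, Option.elim_some, hs,
          if_true, map_sub, map_mul, aeval_X, aeval_C, algebraMap_eq]
        change C (q.1.1.rep i) * _ - C (q.1.1.rep j) * _ = _
        rw [lineThrough, lineThrough]
        ring
      · simp [BlowUp.generic, q.chartCoord_inr_of_ne hs, hs, algebraMap_eq]

variable {q : BlowUp S} {hq : q.proj ∈ S} {i₀ i₁ : Fin 5}

/-- The rational functions `e = ξ₀₁ / y₀` (at `none`) and `uⱼ = ξ₀ⱼ / ξ₀₁` (at `some j`), where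
`ξ = p ∧ y`; they satisfy `p + e u = (p₀ / y₀) y`. -/
def BlowUp.chartFun (q : BlowUp S) (i₀ i₁ : Fin 5) (o : Option (Fin 5)) :
    FractionRing (MvPolynomial (Fin 5) ℂ) :=
  o.elim (algebraMap _ _ (C (q.1.1.rep i₀) * X i₁ - C (q.1.1.rep i₁) * X i₀) /
      algebraMap (MvPolynomial (Fin 5) ℂ) _ (X i₀))
    fun j => algebraMap _ _ (C (q.1.1.rep i₀) * X j - C (q.1.1.rep j) * X i₀) /
      algebraMap (MvPolynomial (Fin 5) ℂ) _ (C (q.1.1.rep i₀) * X i₁ - C (q.1.1.rep i₁) * X i₀)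

/-- The values of the functions `e` and `uⱼ` at the point `q`. -/
def BlowUp.chartPoint (q : BlowUp S) (hq : q.proj ∈ S) (i₀ i₁ : Fin 5) (o : Option (Fin 5)) : ℂ :=
  o.elim 0 fun j => (q.1.2 ⟨q.proj, hq⟩).rep (i₀, j) / (q.1.2 ⟨q.proj, hq⟩).rep (i₀, i₁)

open Classical in
theorem BlowUp.IsChart.exists_eval_chartCoord (h : q.IsChart hq i₀ i₁) (k : Option S →₀ ℕ) :
    ∃ c : ℂ, c ≠ 0 ∧ ∀ A : MvPolynomial (BlowUp.Coord S) ℂ,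
      IsWeightedHomogeneous (BlowUp.weight S) A k →
        eval (q.chartPoint hq i₀ i₁) (aeval q.chartCoord A) = c * eval q.coords A := by
  have hex : ∀ s : S, ∃ a : ℂ, a ≠ 0 ∧ ∀ ij,
      eval (q.chartPoint hq i₀ i₁) (q.chartCoord (.inr (s, ij))) = a * (q.1.2 s).rep ij := by
    intro s
    by_cases hs : s.1 = q.proj
    · obtain rfl : s = ⟨q.proj, hq⟩ := Subtype.ext hs
      refine ⟨q.1.1.rep i₀ / (q.1.2 ⟨q.proj, hq⟩).rep (i₀, i₁),
        div_ne_zero h.base_ne_zero h.direction_ne_zero, ?_⟩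
      rintro ⟨i, j⟩
      have h1 := h.direction_ne_zero
      rw [q.chartCoord_inr_self rfl]
      simp only [map_sub, map_mul, eval_C, eval_X, BlowUp.chartPoint, Option.elim_some]
      field_simp
      exact q.direction_relation hq i j i₀
    · obtain ⟨a, ha, ha'⟩ := q.exists_join_eq s hs
      refine ⟨a, ha, ?_⟩
      rintro ⟨i, j⟩
      rw [← ha', q.chartCoord_inr_of_ne hs]
      simp [lineThrough, BlowUp.chartPoint, joinMap]
  choose a ha ha' using hex
  refine ⟨powChar (fun o => o.elim 1 a) (.ofAdd k), powChar_ne_zero ?_ _, fun A hA => ?_⟩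
  · rintro (_ | s)
    · exact one_ne_zero
    · exact ha s
  · rw [← coe_aeval_eq_eval, ← coe_aeval_eq_eval, RingHom.coe_coe, RingHom.coe_coe,
      ← BlowUp.aeval_eq_powChar_mul (y := fun j => aeval (q.chartPoint hq i₀ i₁)
        (q.chartCoord j)) _ ?_ ?_ hA]
    · rw [← AlgHom.comp_apply, comp_aeval]
    · intro i
      simp [BlowUp.chartCoord_inl, lineThrough, BlowUp.chartPoint, BlowUp.coords]
    · intro s ij
      exact ha' s ij

theorem BlowUp.IsChart.eval_chartCoord_ne_zero (h : q.IsChart hq i₀ i₁)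
    {A : MvPolynomial (BlowUp.Coord S) ℂ} {k : Option S →₀ ℕ}
    (hA : IsWeightedHomogeneous (BlowUp.weight S) A k) (hA0 : eval q.coords A ≠ 0) :
    eval (q.chartPoint hq i₀ i₁) (aeval q.chartCoord A) ≠ 0 := by
  obtain ⟨c, hc, hc'⟩ := h.exists_eval_chartCoord k
  rw [hc' A hA]
  exact mul_ne_zero hc hA0

/-- The points of the exceptional divisor lie in the closure of the generic point. -/
theorem BlowUp.IsChart.aeval_generic_ne_zero (h : q.IsChart hq i₀ i₁)
    {A : MvPolynomial (BlowUp.Coord S) ℂ} {k : Option S →₀ ℕ}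
    (hA : IsWeightedHomogeneous (BlowUp.weight S) A k) (hA0 : eval q.coords A ≠ 0) :
    aeval (BlowUp.generic S) A ≠ 0 := by
  intro h0
  obtain ⟨c, hc, hc'⟩ := q.exists_aeval_lineThrough_generic k
  have h1 := hc' A hA
  rw [h0, map_zero, eq_comm, mul_eq_zero] at h1
  have h2 := h.eval_chartCoord_ne_zero hA hA0
  rw [h1.resolve_left hc, map_zero] at h2
  exact h2 rfl

theorem BlowUp.isWeightedHomogeneous_direction (s : S) (ij : Fin 5 × Fin 5) :
    IsWeightedHomogeneous (BlowUp.weight S) (X (.inr (s, ij)) : MvPolynomial (BlowUp.Coord S) ℂ)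
      (Finsupp.single (some s) 1) := isWeightedHomogeneous_X _ _ _

theorem BlowUp.IsChart.direction_generic_ne_zero (h : q.IsChart hq i₀ i₁) :
    (C (q.1.1.rep i₀) * X i₁ - C (q.1.1.rep i₁) * X i₀ : MvPolynomial (Fin 5) ℂ) ≠ 0 := by
  have := h.aeval_generic_ne_zero (BlowUp.isWeightedHomogeneous_direction ⟨q.proj, hq⟩ (i₀, i₁))
    (by rw [eval_X]; exact h.direction_ne_zero)
  rwa [aeval_X] at this

open Classical in
/-- The chart functions recover the homogeneous coordinates up to scaling. -/
theorem BlowUp.IsChart.exists_aeval_chartFun (h : q.IsChart hq i₀ i₁) (k : Option S →₀ ℕ) :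
    ∃ c : FractionRing (MvPolynomial (Fin 5) ℂ), c ≠ 0 ∧
      ∀ A : MvPolynomial (BlowUp.Coord S) ℂ, IsWeightedHomogeneous (BlowUp.weight S) A k →
        aeval (q.chartFun i₀ i₁) (aeval q.chartCoord A) =
          c * algebraMap _ _ (aeval (BlowUp.generic S) A) := by
  have inj := IsFractionRing.injective (MvPolynomial (Fin 5) ℂ)
    (FractionRing (MvPolynomial (Fin 5) ℂ))
  set ι := algebraMap (MvPolynomial (Fin 5) ℂ) (FractionRing (MvPolynomial (Fin 5) ℂ)) with hι
  have hCι : ∀ a : ℂ, algebraMap ℂ (FractionRing (MvPolynomial (Fin 5) ℂ)) a = ι (C a) := fun a =>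
    IsScalarTower.algebraMap_apply ℂ (MvPolynomial (Fin 5) ℂ) _ a
  have hp : ι (C (q.1.1.rep i₀)) ≠ 0 := by
    rw [Ne, map_eq_zero_iff ι inj, C_eq_zero]; exact h.base_ne_zero
  have hy : ι (X i₀) ≠ 0 := by
    rw [Ne, map_eq_zero_iff ι inj]; exact X_ne_zero _
  have hd : ι (C (q.1.1.rep i₀) * X i₁ - C (q.1.1.rep i₁) * X i₀) ≠ 0 := by
    rw [Ne, map_eq_zero_iff ι inj]; exact h.direction_generic_ne_zero
  have hline : ∀ j, aeval (q.chartFun i₀ i₁) (lineThrough q.1.1.rep j) =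
      ι (C (q.1.1.rep i₀)) / ι (X i₀) * ι (X j) := by
    intro j
    simp only [lineThrough, map_add, map_mul, aeval_X, aeval_C, hCι, BlowUp.chartFun,
      Option.elim_none, Option.elim_some]
    rw [← hι, div_mul_div_comm, mul_comm (ι (X i₀)), mul_div_mul_left _ _ hd]
    field_simp
    simp only [map_sub, map_mul]
    ring
  refine ⟨powChar (fun o => o.elim (ι (C (q.1.1.rep i₀)) / ι (X i₀)) fun s =>
      if s.1 = q.proj then ι (C (q.1.1.rep i₀)) /
        ι (C (q.1.1.rep i₀) * X i₁ - C (q.1.1.rep i₁) * X i₀)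
      else ι (C (q.1.1.rep i₀)) / ι (X i₀)) (.ofAdd k),
    powChar_ne_zero ?_ _, fun A hA => ?_⟩
  · rintro (_ | s)
    · exact div_ne_zero hp hy
    · change (if _ then _ else _) ≠ _
      split_ifs
      · exact div_ne_zero hp hd
      · exact div_ne_zero hp hy
  · rw [← aeval_algebraMap_apply, ← BlowUp.aeval_eq_powChar_mul
      (y := fun j => aeval (q.chartFun i₀ i₁) (q.chartCoord j)) _ ?_ ?_ hA]
    · rw [← AlgHom.comp_apply, comp_aeval]
    · intro i
      exact hline i
    · rintro s ⟨i, j⟩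
      by_cases hs : s.1 = q.proj
      · simp only [BlowUp.generic, Sum.elim_inr, q.chartCoord_inr_self hs, Option.elim_some, hs,
          if_true, map_sub, map_mul, aeval_X, aeval_C, Function.comp, BlowUp.chartFun, hCι]
        simp only [← map_mul, ← map_sub]
        change _ = _ * ι (C (q.1.1.rep i) * X j - C (q.1.1.rep j) * X i)
        rw [← hι]
        field_simp
        simp only [map_sub, map_mul]
        ring
      · simp only [BlowUp.generic, Sum.elim_inr, q.chartCoord_inr_of_ne hs, Option.elim_some, hs,
          if_false, map_sub, map_mul, aeval_C, Function.comp, hCι, hline]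
        ring

end Chart

/-! ### The local ring at a point of the exceptional divisor -/

section LocalRing

variable {S : Set P4} {q : BlowUp S} {hq : q.proj ∈ S} {i₀ i₁ : Fin 5}

/-- The rational function `x` is regular at `q` with value `c`. -/
def BlowUp.HasValue (q : BlowUp S) (x : FractionRing (MvPolynomial (Fin 5) ℂ)) (c : ℂ) : Prop :=
  ∃ (k : Option S →₀ ℕ) (A B : MvPolynomial (BlowUp.Coord S) ℂ),
    IsWeightedHomogeneous (BlowUp.weight S) A k ∧ IsWeightedHomogeneous (BlowUp.weight S) B k ∧
    aeval (BlowUp.generic S) B ≠ 0 ∧ eval q.coords B ≠ 0 ∧ eval q.coords A = c * eval q.coords B ∧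
    x = algebraMap _ _ (aeval (BlowUp.generic S) A) / algebraMap _ _ (aeval (BlowUp.generic S) B)

theorem BlowUp.HasValue.exists_germ {x : FractionRing (MvPolynomial (Fin 5) ℂ)} {c : ℂ}
    (h : q.HasValue x c) :
    ∃ g : localRingBl q, ((g : KBl S) : FractionRing (MvPolynomial (Fin 5) ℂ)) = x := by
  obtain ⟨k, A, B, hA, hB, h0, hb, -, hx⟩ := h
  exact ⟨⟨⟨x, k, A, B, hA, hB, h0, hx⟩, k, A, B, hA, hB, h0, hb, hx⟩, rfl⟩

theorem BlowUp.hasValue_algebraMap (q : BlowUp S) (c : ℂ) :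
    q.HasValue (algebraMap ℂ _ c) c := by
  refine ⟨0, C c, 1, isWeightedHomogeneous_C _ c, isWeightedHomogeneous_one ℂ _, by simp, by simp,
    by simp, ?_⟩
  rw [map_one, map_one, div_one, aeval_C, ← IsScalarTower.algebraMap_apply]

theorem BlowUp.HasValue.add {x y : FractionRing (MvPolynomial (Fin 5) ℂ)} {c c' : ℂ}
    (hx : q.HasValue x c) (hy : q.HasValue y c') : q.HasValue (x + y) (c + c') := by
  obtain ⟨k, A, B, hA, hB, h0, hb, ha, rfl⟩ := hx
  obtain ⟨k', A', B', hA', hB', h0', hb', ha', rfl⟩ := hy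
  refine ⟨k + k', A * B' + B * A', B * B', (hA.mul hB').add (hB.mul hA'), hB.mul hB',
    ?_, ?_, ?_, ?_⟩
  · simpa using ⟨h0, h0'⟩
  · simpa using ⟨hb, hb'⟩
  · simp only [map_add, map_mul, ha, ha']; ring
  · have e := (IsFractionRing.injective (MvPolynomial (Fin 5) ℂ)
      (FractionRing (MvPolynomial (Fin 5) ℂ))).ne h0
    have e' := (IsFractionRing.injective (MvPolynomial (Fin 5) ℂ)
      (FractionRing (MvPolynomial (Fin 5) ℂ))).ne h0'
    rw [map_zero] at e e'
    simp only [map_mul, map_add, div_add_div _ _ e e']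

theorem BlowUp.HasValue.mul {x y : FractionRing (MvPolynomial (Fin 5) ℂ)} {c c' : ℂ}
    (hx : q.HasValue x c) (hy : q.HasValue y c') : q.HasValue (x * y) (c * c') := by
  obtain ⟨k, A, B, hA, hB, h0, hb, ha, rfl⟩ := hx
  obtain ⟨k', A', B', hA', hB', h0', hb', ha', rfl⟩ := hy
  refine ⟨k + k', A * A', B * B', hA.mul hA', hB.mul hB', ?_, ?_, ?_, ?_⟩
  · simpa using ⟨h0, h0'⟩
  · simpa using ⟨hb, hb'⟩
  · simp only [map_mul, ha, ha']; ring
  · simp only [map_mul, div_mul_div_comm]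

theorem BlowUp.HasValue.inv (h : q.IsChart hq i₀ i₁)
    {x : FractionRing (MvPolynomial (Fin 5) ℂ)} {c : ℂ} (hx : q.HasValue x c) (hc : c ≠ 0) :
    x ≠ 0 ∧ q.HasValue x⁻¹ c⁻¹ := by
  obtain ⟨k, A, B, hA, hB, h0, hb, ha, rfl⟩ := hx
  have hA0 : eval q.coords A ≠ 0 := by rw [ha]; exact mul_ne_zero hc hb
  have h0' := h.aeval_generic_ne_zero hA hA0
  have inj := IsFractionRing.injective (MvPolynomial (Fin 5) ℂ)
    (FractionRing (MvPolynomial (Fin 5) ℂ))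
  refine ⟨div_ne_zero ?_ ?_, k, B, A, hB, hA, h0', hA0, ?_, inv_div _ _⟩
  · rwa [Ne, map_eq_zero_iff _ inj]
  · rwa [Ne, map_eq_zero_iff _ inj]
  · rw [ha, inv_mul_cancel_left₀ hc]

theorem BlowUp.IsChart.hasValue_chartFun (h : q.IsChart hq i₀ i₁) (o : Option (Fin 5)) :
    q.HasValue (q.chartFun i₀ i₁ o) (q.chartPoint hq i₀ i₁ o) := by
  have hX : ∀ i, IsWeightedHomogeneous (BlowUp.weight S)
      (X (.inl i) : MvPolynomial (BlowUp.Coord S) ℂ) (Finsupp.single none 1) := fun i =>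
    isWeightedHomogeneous_X _ _ _
  rcases o with _ | j
  · refine ⟨Finsupp.single none 1, C (q.1.1.rep i₀) * X (.inl i₁) - C (q.1.1.rep i₁) * X (.inl i₀),
      X (.inl i₀), ?_, hX i₀, ?_, ?_, ?_, ?_⟩
    · have hC : ∀ a i, IsWeightedHomogeneous (BlowUp.weight S)
          (C a * X (.inl i) : MvPolynomial (BlowUp.Coord S) ℂ) (Finsupp.single none 1) := fun a i =>
        by simpa using (isWeightedHomogeneous_C (BlowUp.weight S) a).mul (hX i)
      exact (hC _ _).sub (hC _ _)
    · rw [aeval_X]; exact X_ne_zero _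
    · rw [eval_X]; exact h.base_ne_zero
    · simp only [BlowUp.chartPoint, BlowUp.coords, Option.elim_none, map_sub, map_mul, eval_C,
        eval_X, Sum.elim_inl]
      ring
    · simp only [BlowUp.chartFun, Option.elim_none, map_sub, map_mul, aeval_C, aeval_X,
        BlowUp.generic, Sum.elim_inl, algebraMap_eq]
  · refine ⟨_, X (.inr (⟨q.proj, hq⟩, (i₀, j))), X (.inr (⟨q.proj, hq⟩, (i₀, i₁))),
      BlowUp.isWeightedHomogeneous_direction _ _, BlowUp.isWeightedHomogeneous_direction _ _,
      ?_, ?_, ?_, ?_⟩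
    · rw [aeval_X]; exact h.direction_generic_ne_zero
    · rw [eval_X]; exact h.direction_ne_zero
    · rw [eval_X, eval_X]
      exact (div_mul_cancel₀ _ h.direction_ne_zero).symm
    · rw [aeval_X, aeval_X]
      rfl

theorem BlowUp.IsChart.hasValue_aeval (h : q.IsChart hq i₀ i₁)
    (b : MvPolynomial (Option (Fin 5)) ℂ) :
    q.HasValue (aeval (q.chartFun i₀ i₁) b) (eval (q.chartPoint hq i₀ i₁) b) := by
  induction b using MvPolynomial.induction_on with
  | C a =>
    rw [eval_C, aeval_C]
    exact q.hasValue_algebraMap a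
  | add a b ha hb =>
    rw [map_add, map_add]
    exact ha.add hb
  | mul_X a o ha =>
    rw [map_mul, map_mul, aeval_X, eval_X]
    exact ha.mul (h.hasValue_chartFun o)

/-- A local equation `e` of the exceptional divisor at `q`. -/
def BlowUp.IsChart.excEq (h : q.IsChart hq i₀ i₁) : localRingBl q :=
  (h.hasValue_chartFun none).exists_germ.choose

theorem BlowUp.IsChart.coe_excEq (h : q.IsChart hq i₀ i₁) :
    ((h.excEq : KBl S) : FractionRing (MvPolynomial (Fin 5) ℂ)) = q.chartFun i₀ i₁ none :=
  (h.hasValue_chartFun none).exists_germ.choose_spec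

/-- A fraction whose numerator becomes divisible by `t` on the pencil of lines is divisible by the
local equation of the exceptional divisor. -/
theorem BlowUp.IsChart.excEq_dvd (h : q.IsChart hq i₀ i₁) {x : localRingBl q}
    {k : Option S →₀ ℕ} {A B : MvPolynomial (BlowUp.Coord S) ℂ}
    (hA : IsWeightedHomogeneous (BlowUp.weight S) A k)
    (hB : IsWeightedHomogeneous (BlowUp.weight S) B k) (hb : eval q.coords B ≠ 0)
    (hx : ((x : KBl S) : FractionRing (MvPolynomial (Fin 5) ℂ)) =
      algebraMap _ _ (aeval (BlowUp.generic S) A) / algebraMap _ _ (aeval (BlowUp.generic S) B))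
    (ht : X none ∣ aeval q.chartCoord A) : h.excEq ∣ x := by
  obtain ⟨c, hc, hc'⟩ := h.exists_aeval_chartFun k
  obtain ⟨a, ha⟩ := ht
  obtain ⟨-, hinv⟩ := (h.hasValue_aeval (aeval q.chartCoord B)).inv h
    (h.eval_chartCoord_ne_zero hB hb)
  obtain ⟨g, hg⟩ := ((h.hasValue_aeval a).mul hinv).exists_germ
  refine ⟨g, Subtype.ext (Subtype.ext ?_)⟩
  rw [hx]
  push_cast
  rw [hg, h.coe_excEq, ← mul_div_mul_left _ _ hc, ← hc' A hA, ← hc' B hB, ha, map_mul, aeval_X]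
  ring

/-- The expansion of a germ at `q` along the pencil of lines through the base point, as a fraction
whose denominator does not vanish at `q`. -/
theorem BlowUp.IsChart.exists_lineField_mul (h : q.IsChart hq i₀ i₁) (x : localRingBl q) :
    ∃ a b : MvPolynomial (Option (Fin 5)) ℂ, eval (q.chartPoint hq i₀ i₁) b ≠ 0 ∧
      lineField q.1.1.rep ((x : KBl S) : FractionRing (MvPolynomial (Fin 5) ℂ)) *
        algebraMap _ _ b = algebraMap _ _ a ∧ (X none ∣ a → h.excEq ∣ x) := by
  obtain ⟨k, A, B, hA, hB, h0, hb, hx⟩ := x.2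
  obtain ⟨c, hc, hc'⟩ := q.exists_aeval_lineThrough_generic k
  have hb' := h.eval_chartCoord_ne_zero hB hb
  refine ⟨aeval q.chartCoord A, aeval q.chartCoord B, hb', ?_, h.excEq_dvd hA hB hb hx⟩
  have inj := IsFractionRing.injective (MvPolynomial (Option (Fin 5)) ℂ)
    (FractionRing (MvPolynomial (Option (Fin 5)) ℂ))
  have hB0 : algebraMap (MvPolynomial (Option (Fin 5)) ℂ)
      (FractionRing (MvPolynomial (Option (Fin 5)) ℂ)) (aeval q.chartCoord B) ≠ 0 := by
    rw [Ne, map_eq_zero_iff _ inj]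
    intro h0
    rw [h0, map_zero] at hb'
    exact hb' rfl
  have hc0 : algebraMap (MvPolynomial (Option (Fin 5)) ℂ)
      (FractionRing (MvPolynomial (Option (Fin 5)) ℂ)) c ≠ 0 := by
    rwa [Ne, map_eq_zero_iff _ inj]
  rw [hx, map_div₀, lineField_algebraMap, lineField_algebraMap, hc' A hA, hc' B hB, map_mul,
    map_mul, mul_div_mul_left _ _ hc0, div_mul_cancel₀ _ hB0]

theorem BlowUp.not_X_none_dvd {b : MvPolynomial (Option (Fin 5)) ℂ}
    (hb : eval (q.chartPoint hq i₀ i₁) b ≠ 0) : ¬ X none ∣ b := by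
  rintro ⟨c, rfl⟩
  apply hb
  rw [map_mul, eval_X]
  exact zero_mul _

theorem not_X_none_dvd_lineThrough {p : Fin 5 → ℂ} {i : Fin 5} (hp : p i ≠ 0) :
    ¬ X none ∣ lineThrough p i := by
  rintro ⟨c, hc⟩
  have := congrArg (eval fun _ => (0 : ℂ)) hc
  rw [lineThrough] at this
  simp at this
  exact hp this

theorem BlowUp.IsChart.lineField_excEq (h : q.IsChart hq i₀ i₁) :
    lineField q.1.1.rep ((h.excEq : KBl S) : FractionRing (MvPolynomial (Fin 5) ℂ)) *
        algebraMap _ _ (lineThrough q.1.1.rep i₀) =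
      algebraMap _ _
        (X none * (C (q.1.1.rep i₀) * X (some i₁) - C (q.1.1.rep i₁) * X (some i₀))) := by
  have inj := IsFractionRing.injective (MvPolynomial (Option (Fin 5)) ℂ)
    (FractionRing (MvPolynomial (Option (Fin 5)) ℂ))
  have h0 : algebraMap (MvPolynomial (Option (Fin 5)) ℂ)
      (FractionRing (MvPolynomial (Option (Fin 5)) ℂ)) (lineThrough q.1.1.rep i₀) ≠ 0 := by
    rw [Ne, map_eq_zero_iff _ inj]
    intro h0
    exact not_X_none_dvd_lineThrough h.base_ne_zero (h0 ▸ dvd_zero _)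
  rw [h.coe_excEq, BlowUp.chartFun, Option.elim_none, map_div₀, lineField_algebraMap,
    lineField_algebraMap, aeval_X, div_mul_cancel₀ _ h0]
  congr 1
  simp only [map_sub, map_mul, aeval_C, aeval_X, algebraMap_eq, lineThrough]
  ring

/-- The exceptional divisor is reduced and irreducible at each of its points. -/
theorem BlowUp.IsChart.prime_excEq (h : q.IsChart hq i₀ i₁) : Prime h.excEq := by
  have inj := IsFractionRing.injective (MvPolynomial (Option (Fin 5)) ℂ)
    (FractionRing (MvPolynomial (Option (Fin 5)) ℂ))
  have hX : Prime (X none : MvPolynomial (Option (Fin 5)) ℂ) := X_prime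
  have hL := not_X_none_dvd_lineThrough h.base_ne_zero
  have he := h.lineField_excEq
  refine ⟨?_, ?_, ?_⟩
  · intro h0
    have h1 := h.coe_excEq
    rw [h0] at h1
    have h2 := h.direction_generic_ne_zero
    rw [BlowUp.chartFun, Option.elim_none, eq_comm] at h1
    have inj' := IsFractionRing.injective (MvPolynomial (Fin 5) ℂ)
      (FractionRing (MvPolynomial (Fin 5) ℂ))
    rcases div_eq_zero_iff.1 h1 with h1 | h1
    · exact h2 ((map_eq_zero_iff _ inj').1 h1)
    · exact X_ne_zero _ ((map_eq_zero_iff _ inj').1 h1)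
  · rintro hu
    obtain ⟨y, hy⟩ := hu.exists_right_inv
    obtain ⟨a, b, hb, hab, -⟩ := h.exists_lineField_mul y
    have hy' := congrArg (fun g : localRingBl q =>
      lineField q.1.1.rep ((g : KBl S) : FractionRing (MvPolynomial (Fin 5) ℂ))) hy
    simp only [MulMemClass.coe_mul, OneMemClass.coe_one, map_mul, map_one] at hy'
    -- Clearing denominators in the expansion of `e y = 1` along the pencil.
    have key : lineThrough q.1.1.rep i₀ * b = X none *
        (C (q.1.1.rep i₀) * X (some i₁) - C (q.1.1.rep i₁) * X (some i₀)) * a := by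
      apply inj
      rw [map_mul, map_mul _ _ a, ← he, ← hab]
      linear_combination (-(algebraMap _ _ (lineThrough q.1.1.rep i₀) * algebraMap _ _ b)) * hy'
    have hd : X none ∣ lineThrough q.1.1.rep i₀ * b := ⟨_, by rw [key, mul_assoc]⟩
    exact (hX.dvd_or_dvd hd).elim hL (BlowUp.not_X_none_dvd hb)
  · rintro x y ⟨z, hz⟩
    obtain ⟨a, b, hb, hab, hx⟩ := h.exists_lineField_mul x
    obtain ⟨a', b', hb', hab', hy⟩ := h.exists_lineField_mul y
    obtain ⟨a'', b'', hb'', hab'', -⟩ := h.exists_lineField_mul z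
    have hz' := congrArg (fun g : localRingBl q =>
      lineField q.1.1.rep ((g : KBl S) : FractionRing (MvPolynomial (Fin 5) ℂ))) hz
    simp only [MulMemClass.coe_mul, map_mul] at hz'
    -- Clearing denominators in the expansion of `x y = e z` along the pencil.
    have key : a * a' * (lineThrough q.1.1.rep i₀ * b'') = X none *
        (C (q.1.1.rep i₀) * X (some i₁) - C (q.1.1.rep i₁) * X (some i₀)) * (a'' * b * b') := by
      apply inj
      rw [map_mul, map_mul, map_mul _ (lineThrough _ _), map_mul _ _ (a'' * b * b'), ← he, ← hab,
        ← hab', map_mul, map_mul, ← hab'']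
      linear_combination (algebraMap _ _ (lineThrough q.1.1.rep i₀) * algebraMap _ _ b *
        algebraMap _ _ b' * algebraMap _ _ b'') * hz'
    have hd : X none ∣ a * a' * (lineThrough q.1.1.rep i₀ * b'') := ⟨_, by rw [key, mul_assoc]⟩
    rcases hX.dvd_or_dvd hd with hd | hd
    · exact (hX.dvd_or_dvd hd).imp hx hy
    · exact absurd hd (fun hd => (hX.dvd_or_dvd hd).elim hL (BlowUp.not_X_none_dvd hb''))

end LocalRing

/-! ### Germs pulled back from projective space -/

section Pullback

variable {S : Set P4} {q : BlowUp S} {hq : q.proj ∈ S} {i₀ i₁ : Fin 5}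

theorem exists_germP (x : P4) {k : ℕ} {A B : MvPolynomial (Fin 5) ℂ} (hA : A.IsHomogeneous k)
    (hB : B.IsHomogeneous k) (hb : eval x.rep B ≠ 0) :
    ∃ g : localRingP x, ((g : KP) : FractionRing (MvPolynomial (Fin 5) ℂ)) =
      algebraMap (MvPolynomial (Fin 5) ℂ) _ A / algebraMap (MvPolynomial (Fin 5) ℂ) _ B := by
  have h0 : aeval (X : Fin 5 → MvPolynomial (Fin 5) ℂ) B ≠ 0 := by
    rw [aeval_X_left_apply]
    rintro rfl
    exact hb (map_zero _)
  have e : algebraMap (MvPolynomial (Fin 5) ℂ) (FractionRing (MvPolynomial (Fin 5) ℂ)) A /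
        algebraMap (MvPolynomial (Fin 5) ℂ) _ B =
      algebraMap (MvPolynomial (Fin 5) ℂ) _ (aeval X A) /
        algebraMap (MvPolynomial (Fin 5) ℂ) _ (aeval X B) := by
    rw [aeval_X_left_apply, aeval_X_left_apply]
  exact ⟨⟨⟨_, k, A, B, hA, hB, h0, e⟩, k, A, B, hA, hB, h0, hb, e⟩, rfl⟩

/-- The germ of a function of projective space at the centre is constant modulo the local equation
of the exceptional divisor. -/
theorem BlowUp.IsChart.excEq_dvd_pullbackGerm_sub (h : q.IsChart hq i₀ i₁)
    {g : localRingP q.proj} {k : ℕ} {A B : MvPolynomial (Fin 5) ℂ} (hA : A.IsHomogeneous k)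
    (hB : B.IsHomogeneous k) (hb : eval q.proj.rep B ≠ 0)
    (hg : ((g : KP) : FractionRing (MvPolynomial (Fin 5) ℂ)) =
      algebraMap (MvPolynomial (Fin 5) ℂ) _ A / algebraMap (MvPolynomial (Fin 5) ℂ) _ B) :
    h.excEq ∣ pullbackGerm q g - algebraMap ℂ _ (eval q.proj.rep A / eval q.proj.rep B) := by
  set c := eval q.proj.rep A / eval q.proj.rep B
  have hgen : ∀ P : MvPolynomial (Fin 5) ℂ,
      aeval (BlowUp.generic S) (rename Sum.inl P) = P := fun P => by
    rw [aeval_rename]; exact aeval_X_left_apply P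
  have hc : (A - C c * B).IsHomogeneous k := by
    refine hA.sub ?_
    simpa using (isHomogeneous_C (Fin 5) c).mul hB
  refine h.excEq_dvd (A := rename Sum.inl (A - C c * B)) (B := rename Sum.inl B)
    (BlowUp.isWeightedHomogeneous_rename hc) (BlowUp.isWeightedHomogeneous_rename hB) ?_ ?_ ?_
  · rw [eval_rename]; exact hb
  · rw [hgen, hgen]
    have hB0 : algebraMap _ (FractionRing (MvPolynomial (Fin 5) ℂ)) B ≠ 0 := by
      rw [Ne, map_eq_zero_iff _ (IsFractionRing.injective _ _)]
      rintro rfl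
      exact hb (map_zero _)
    rw [map_sub, map_mul, sub_div, mul_div_cancel_right₀ _ hB0, ← hg,
      ← algebraMap_eq, ← IsScalarTower.algebraMap_apply]
    rfl
  · rw [aeval_rename]
    have := X_none_dvd_aeval_lineThrough_sub q.1.1.rep (A - C c * B)
    have h0 : eval q.1.1.rep (A - C c * B) = 0 := by
      rw [map_sub, map_mul, eval_C]
      exact sub_eq_zero.2 (div_mul_cancel₀ _ hb).symm
    rwa [h0, C_0, sub_zero] at this

theorem BlowUp.IsChart.exists_excEq_dvd_sub (h : q.IsChart hq i₀ i₁) (g : localRingP q.proj) :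
    ∃ c : ℂ, h.excEq ∣ pullbackGerm q g - algebraMap ℂ _ c := by
  obtain ⟨k, A, B, hA, hB, h0, hb, hg⟩ := g.2
  rw [aeval_X_left_apply, aeval_X_left_apply] at hg
  exact ⟨_, h.excEq_dvd_pullbackGerm_sub hA hB hb hg⟩

theorem BlowUp.IsChart.excEq_dvd_of_mem_maxIdealP (h : q.IsChart hq i₀ i₁)
    {g : localRingP q.proj} (hg : g ∈ maxIdealP q.proj) : h.excEq ∣ pullbackGerm q g := by
  suffices maxIdealP q.proj ≤ (Ideal.span {h.excEq}).comap (pullbackGerm q) from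
    Ideal.mem_span_singleton.1 (this hg)
  refine Ideal.span_le.2 ?_
  rintro x ⟨k, A, B, hA, hB, hb, ha, hx⟩
  exact Ideal.mem_span_singleton.2 (dvd_of_dvd_sub_algebraMap
    (O := localRingBl q) (h.excEq_dvd_pullbackGerm_sub hA hB hb hx) (div_eq_zero_iff.2 (.inl ha)))

theorem BlowUp.IsChart.excEq_mem_exceptionalIdeal (h : q.IsChart hq i₀ i₁) :
    h.excEq ∈ exceptionalIdeal q := by
  rw [exceptionalIdeal, if_pos hq]
  have hA : (C (q.1.1.rep i₀) * X i₁ - C (q.1.1.rep i₁) * X i₀ :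
      MvPolynomial (Fin 5) ℂ).IsHomogeneous 1 := by
    have hC : ∀ a i, (C a * X i : MvPolynomial (Fin 5) ℂ).IsHomogeneous 1 := fun a i => by
      simpa using (isHomogeneous_C (Fin 5) a).mul (isHomogeneous_X ℂ i)
    exact (hC _ _).sub (hC _ _)
  have hb : eval q.proj.rep (X i₀) ≠ 0 := by rw [eval_X]; exact h.base_ne_zero
  obtain ⟨g, hg⟩ := exists_germP q.proj hA (isHomogeneous_X ℂ i₀) hb
  have hge : pullbackGerm q g = h.excEq := Subtype.ext (Subtype.ext (by
    rw [h.coe_excEq]; exact hg))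
  rw [← hge]
  refine Ideal.mem_map_of_mem _ (Ideal.subset_span ⟨1, _, _, hA, isHomogeneous_X ℂ i₀, hb, ?_, hg⟩)
  simp only [map_sub, map_mul, eval_C, eval_X]
  exact sub_eq_zero.2 (mul_comm _ _)

end Pullback

/-! ### The strict transform at a node -/

section StrictTransform

variable {S : Set P4} {q : BlowUp S} {hq : q.proj ∈ S} {i₀ i₁ : Fin 5}
  {f : MvPolynomial (Fin 5) ℂ} {d : ℕ}

theorem hypersurfaceIdeal_le_span (hf : f.IsHomogeneous d) {x : P4} {i : Fin 5} {g : localRingP x}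
    (hg : ((g : KP) : FractionRing (MvPolynomial (Fin 5) ℂ)) =
      algebraMap (MvPolynomial (Fin 5) ℂ) _ f / algebraMap (MvPolynomial (Fin 5) ℂ) _ (X i ^ d)) :
    hypersurfaceIdeal f x ≤ Ideal.span {g} := by
  refine Ideal.span_le.2 ?_
  rintro y ⟨k, A, B, hA, hB, hb, hfA, hy⟩
  refine Ideal.mem_span_singleton.2 ?_
  obtain rfl | ⟨l, c, hc, rfl, rfl⟩ := exists_isHomogeneous_cofactor hf hA hfA
  · rw [map_zero, zero_div] at hy
    obtain rfl : y = 0 := Subtype.ext (Subtype.ext hy)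
    exact dvd_zero _
  · have hX : (X i ^ d : MvPolynomial (Fin 5) ℂ).IsHomogeneous d := by
      simpa using (isHomogeneous_X ℂ i).pow d
    obtain ⟨z, hz⟩ := exists_germP x (hX.mul hc) hB hb
    refine ⟨z, Subtype.ext (Subtype.ext ?_)⟩
    have hX0 : algebraMap (MvPolynomial (Fin 5) ℂ)
        (FractionRing (MvPolynomial (Fin 5) ℂ)) (X i ^ d) ≠ 0 := by
      rw [Ne, map_eq_zero_iff _ (IsFractionRing.injective _ _)]
      exact pow_ne_zero _ (X_ne_zero _)
    push_cast
    rw [hy, hg, hz, map_mul, map_mul]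
    field_simp

theorem totalTransformIdeal_le_span {g : localRingP q.proj}
    (h : hypersurfaceIdeal f q.proj ≤ Ideal.span {g}) :
    totalTransformIdeal f q ≤ Ideal.span {pullbackGerm q g} :=
  map_le_span_singleton (pullbackGerm q) h

/-- The pullback of a local equation of `f = 0` is not divisible by the cube of the equation of the
exceptional divisor, unless all second derivatives of `f` vanish at the centre. -/
theorem BlowUp.IsChart.eval_pderiv_pderiv_eq_zero (h : q.IsChart hq i₀ i₁)
    {g : localRingP q.proj}
    (hg : ((g : KP) : FractionRing (MvPolynomial (Fin 5) ℂ)) =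
      algebraMap (MvPolynomial (Fin 5) ℂ) _ f / algebraMap (MvPolynomial (Fin 5) ℂ) _ (X i₀ ^ d))
    (hdvd : h.excEq ^ 3 ∣ pullbackGerm q g) (i j : Fin 5) :
    eval q.proj.rep (pderiv i (pderiv j f)) = 0 := by
  refine NodalForms.eval_pderiv_pderiv_eq_zero ?_ i j
  change X none ^ 3 ∣ aeval (lineThrough q.1.1.rep) f
  have inj := IsFractionRing.injective (MvPolynomial (Option (Fin 5)) ℂ)
    (FractionRing (MvPolynomial (Option (Fin 5)) ℂ))
  have hX : Prime (X none : MvPolynomial (Option (Fin 5)) ℂ) := X_prime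
  have hL := not_X_none_dvd_lineThrough h.base_ne_zero
  have hL0 : algebraMap (MvPolynomial (Option (Fin 5)) ℂ)
      (FractionRing (MvPolynomial (Option (Fin 5)) ℂ)) (lineThrough q.1.1.rep i₀) ≠ 0 := by
    rw [Ne, map_eq_zero_iff _ inj]
    intro h0
    exact hL (h0 ▸ dvd_zero _)
  obtain ⟨z, hz⟩ := hdvd
  obtain ⟨a, b, hb, hab, -⟩ := h.exists_lineField_mul z
  have he := h.lineField_excEq
  have hz' := congrArg (fun g : localRingBl q =>
    lineField q.1.1.rep ((g : KBl S) : FractionRing (MvPolynomial (Fin 5) ℂ))) hz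
  have hg' : (((pullbackGerm q g : localRingBl q) : KBl S) :
    FractionRing (MvPolynomial (Fin 5) ℂ)) = _ := hg
  simp only [hg', MulMemClass.coe_mul, SubmonoidClass.coe_pow, map_mul, map_pow, map_div₀,
    lineField_algebraMap, aeval_X] at hz'
  rw [div_eq_iff (pow_ne_zero _ hL0)] at hz'
  -- Clearing denominators in the expansion of `g = e ^ 3 z` along the pencil.
  have key : lineThrough q.1.1.rep i₀ ^ 3 * b * aeval (lineThrough q.1.1.rep) f =
      X none ^ 3 * ((C (q.1.1.rep i₀) * X (some i₁) - C (q.1.1.rep i₁) * X (some i₀)) ^ 3 *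
        a * lineThrough q.1.1.rep i₀ ^ d) := by
    apply inj
    rw [← mul_assoc, ← mul_assoc, ← mul_pow]
    simp only [map_mul _ _ (lineThrough q.1.1.rep i₀ ^ d), map_mul _ _ a, map_pow]
    rw [← he, ← hab, map_mul, map_mul, map_pow, hz']
    ring
  refine hX.pow_dvd_of_dvd_mul_left 3 ?_ ⟨_, key⟩
  intro hd
  exact (hX.dvd_or_dvd hd).elim (fun hd => hL (hX.dvd_of_dvd_pow hd)) (BlowUp.not_X_none_dvd hb)

/-- As the multiplicity of a node is two, the equation of the strict transform is the pulled back
equation divided by at most the square of the equation of the exceptional divisor. -/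
theorem BlowUp.IsChart.dvd_sq_mul_of_mem_strictTransformIdeal (h : q.IsChart hq i₀ i₁)
    (hf : f.IsHomogeneous d) (hnode : IsNode f q.proj) {g : localRingP q.proj}
    (hg : ((g : KP) : FractionRing (MvPolynomial (Fin 5) ℂ)) =
      algebraMap (MvPolynomial (Fin 5) ℂ) _ f / algebraMap (MvPolynomial (Fin 5) ℂ) _ (X i₀ ^ d))
    {s : localRingBl q} (hs : s ∈ strictTransformIdeal f q) :
    pullbackGerm q g ∣ h.excEq ^ 2 * s := by
  refine dvd_sq_mul_of_mem_saturation h.prime_excEq h.excEq_mem_exceptionalIdeal ?_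
    (totalTransformIdeal_le_span (hypersurfaceIdeal_le_span hf hg)) hs
  intro hdvd
  have hrank := hnode.2
  have h0 : (Matrix.of fun i j : Fin 5 => eval q.proj.rep (pderiv i (pderiv j f))) = 0 := by
    ext i j
    exact h.eval_pderiv_pderiv_eq_zero hg hdvd i j
  rw [h0, Matrix.rank_zero] at hrank
  exact absurd hrank (by norm_num)

theorem inv_mem_functionField {ι σ M : Type} [AddCommMonoid M] {w : σ → M}
    {θ : σ → MvPolynomial ι ℂ} {x : FractionRing (MvPolynomial ι ℂ)}
    (hx : x ∈ functionField w θ) (h0 : x ≠ 0) : x⁻¹ ∈ functionField w θ := by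
  obtain ⟨k, A, B, hA, hB, hB0, rfl⟩ := hx
  refine ⟨k, B, A, hB, hA, ?_, inv_div _ _⟩
  intro hA0
  rw [hA0, map_zero, zero_div] at h0
  exact h0 rfl

theorem isUnit_of_ne_zero {x : KBl S} (h0 : x ≠ 0) : IsUnit x := by
  have h0' : (x : FractionRing (MvPolynomial (Fin 5) ℂ)) ≠ 0 := fun h => h0 (Subtype.ext h)
  exact IsUnit.of_mul_eq_one ⟨_, inv_mem_functionField x.2 h0'⟩ (Subtype.ext (mul_inv_cancel₀ h0'))

theorem poleOrderLE_of_mem_singularLocus {q : BlowUp (singularLocus f)}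
    (hq : q.proj ∈ singularLocus f) (hf : f.IsHomogeneous d) (hnode : IsNode f q.proj)
    {n m : ℕ} (hnm : 2 * n ≤ m + 3) {ω : RatForm KP}
    (hω : NumeratorMem (localRingP q.proj) (hypersurfaceIdeal f q.proj) (maxIdealP q.proj) n m ω) :
    PoleOrderLE (localRingBl q) (strictTransformIdeal f q) n
      (pullbackForm (singularLocus f) ω) := by
  obtain ⟨i₀, i₁, h⟩ := q.exists_isChart hq
  have hX : (X i₀ ^ d : MvPolynomial (Fin 5) ℂ).IsHomogeneous d := by
    simpa using (isHomogeneous_X ℂ i₀).pow d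
  have hXp : eval q.proj.rep (X i₀ ^ d) ≠ 0 := by
    rw [map_pow, eval_X]
    exact pow_ne_zero _ h.base_ne_zero
  obtain ⟨g, hg⟩ := exists_germP q.proj hf hX hXp
  have hgI : g ∈ hypersurfaceIdeal f q.proj :=
    Ideal.subset_span ⟨d, f, _, hf, hX, hXp, dvd_rfl, hg⟩
  have hunit : IsUnit (h.excEq : KBl (singularLocus f)) :=
    isUnit_of_ne_zero fun h0 => h.prime_excEq.ne_zero (Subtype.ext h0)
  exact poleOrderLE_formPullback_of_numerator (pullbackFun (singularLocus f))
    (pullbackGerm q).toRingHom (fun _ => rfl) h.excEq hunit (maxIdealP q.proj)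
    h.exists_excEq_dvd_sub (fun _ => h.excEq_dvd_of_mem_maxIdealP)
    (fun s hs => h.dvd_sq_mul_of_mem_strictTransformIdeal hf hnode hg hs) hnm
    (hω _ (Ideal.pow_mem_pow hgI n))

theorem poleOrderLE_of_notMem {q : BlowUp S} (hq : q.proj ∉ S) {n : ℕ} {ω : RatForm KP}
    (hω : PoleOrderLE (localRingP q.proj) (hypersurfaceIdeal f q.proj) n ω) :
    PoleOrderLE (localRingBl q) (strictTransformIdeal f q) n (pullbackForm S ω) := by
  have hle : strictTransformIdeal f q ≤ totalTransformIdeal f q := by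
    rintro s ⟨k, hk⟩
    have := hk 1 (by
      rw [exceptionalIdeal, if_neg hq, Ideal.top_pow]
      exact Submodule.mem_top)
    rwa [one_mul] at this
  exact PoleOrderLE.formPullback (pullbackFun S) (pullbackGerm q).toRingHom (fun _ => rfl) hle hω

end StrictTransform

end NodalForms

end

theorem mainTheorem5 (d : ℕ) (f : MvPolynomial (Fin 5) ℂ) (hf : f.IsHomogeneous d)
    (hnodes : ∀ p ∈ NodalForms.singularLocus f, NodalForms.IsNode f p)
    (n m : ℕ) (hN : 0 < 2 * (n : ℤ) - 3) (hm : 2 * (n : ℤ) - 3 ≤ (m : ℤ))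
    (U : Set NodalForms.P4) (hU : NodalForms.IsZariskiOpen U) :
    NodalForms.pullbackForm (NodalForms.singularLocus f) '' NodalForms.adjointForms f n m U ⊆
        NodalForms.strictTransformForms f (NodalForms.singularLocus f) n
          (NodalForms.BlowUp.proj ⁻¹' U) ∧
      ∀ ω ∈ NodalForms.adjointForms f n m U,
        ∀ q : NodalForms.BlowUp (NodalForms.singularLocus f), q.proj ∈ U →
          q ∈ NodalForms.BlowUp.exceptional (NodalForms.singularLocus f) →
          q ∉ NodalForms.strictTransform f (NodalForms.singularLocus f) →
          NodalForms.pullbackForm (NodalForms.singularLocus f) ω ∈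
            NodalForms.regularForms (NodalForms.localRingBl q) := by
  have main : ∀ ω ∈ NodalForms.adjointForms f n m U,
      ∀ q : NodalForms.BlowUp (NodalForms.singularLocus f), q.proj ∈ U →
        NodalForms.PoleOrderLE (NodalForms.localRingBl q) (NodalForms.strictTransformIdeal f q) n
          (NodalForms.pullbackForm (NodalForms.singularLocus f) ω) := by
    intro ω hω q hqU
    by_cases hq : q.proj ∈ NodalForms.singularLocus f
    · exact NodalForms.poleOrderLE_of_mem_singularLocus hq hf (hnodes _ hq) (by omega)
        ((hω _ hqU).2 hq)
    · exact NodalForms.poleOrderLE_of_notMem hq (hω _ hqU).1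
  refine ⟨?_, fun ω hω q hqU _ hq => ?_⟩
  · rintro _ ⟨ω, hω, rfl⟩ q hqU
    exact main ω hω q hqU
  · have htop : NodalForms.strictTransformIdeal f q = ⊤ := not_not.1 hq
    have h1 := main ω hω q hqU
    rw [htop] at h1
    exact h1.mem_regularForms
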